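/- Let $q$ be a prime power. For positive integers $m,\eta,\ell$ put $n=\eta\ell$, let $\mathcal M^\ell=(\mathbb F_q^{m\times\eta})^\ell$, let the sum-rank weight of $\mathbf X=(X_1,\dots,X_\ell)\in\mathcal M^\ell$ be $\sum_{i=1}^{\ell}\operatorname{rank}(X_i)$, and let $\mathcal B(\mathbf 0,r)$ be the set of all $\mathbf X\in\mathcal M^\ell$ of sum-rank weight at most $r$. For every $\rho\in(0,1)$ and every $\beta\in(0,1]$ there is a constant $K>1$, depending only on $q,\rho,\beta$, such that the following holds for all sequences of positive integers $m=m_k$, $\eta=\eta_k$, $\ell=\ell_k$, $\gamma=\gamma_k$ with $m\to\infty$, $\beta m\le\eta\le m$ and $\gamma=o(\sqrt{mn})$ as $k\to\infty$ (in particular whenever $\eta\le m$ and $m,\eta,\ell=\Theta(k)$ with implied constants whose ratio bounds $\eta/m$ below by $\beta$): if $\mathbf X_1,\dots,\mathbf X_\gamma$ are drawn independently and uniformly at random from $\mathcal B(\mathbf 0,\rho n)$, then $$\Pr\Bigl[\bigl|\operatorname{span}_{\mathbb F_q}\{\mathbf X_1,\dots,\mathbf X_\gamma\}\cap\mathcal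 B(\mathbf 0,\rho n)\bigr|\ge K\gamma\Bigr]\le q^{-(3-o(1))mn},$$ where $o(1)$ is a quantity tending to $0$ as $k\to\infty$. -/

import Mathlib

open Filter Topology Asymptotics MeasureTheory ProbabilityTheory

/-- The `F`-vector space of `ℓ`-tuples of `m × η` matrices over `F`. -/
abbrev MatTuple (F : Type*) (m η ℓ : ℕ) : Type _ :=
  Fin ℓ → Matrix (Fin m) (Fin η) F

/-- The sum-rank weight: the sum of the ranks of the `ℓ` blocks. -/
noncomputable def sumRankWeight {F : Type*} [Field F] {m η ℓ : ℕ}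
    (X : MatTuple F m η ℓ) : ℕ :=
  ∑ i, (X i).rank

/-- The sum-rank distance. -/
noncomputable def sumRankDist {F : Type*} [Field F] {m η ℓ : ℕ}
    (X Y : MatTuple F m η ℓ) : ℕ :=
  sumRankWeight (X - Y)

/-- The closed sum-rank metric ball with centre `X` and (real) radius `r`. -/
def sumRankBall {F : Type*} [Field F] {m η ℓ : ℕ}
    (X : MatTuple F m η ℓ) (r : ℝ) : Set (MatTuple F m η ℓ) :=
  {Y | (sumRankDist X Y : ℝ) ≤ r}

/-- The probability that `(X₁, …, X_γ)` lies in `E`, when the `X_j` are drawn independently and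
uniformly from the sum-rank ball of radius `r` around `0`: the mass of `E` under the `γ`-fold
product of the uniform distribution on the ball (all subsets of the space are events). -/
noncomputable def iidBallProb {F : Type*} [Field F] {m η ℓ : ℕ} (r : ℝ) (γ : ℕ)
    (E : Set (Fin γ → MatTuple F m η ℓ)) : ℝ :=
  letI : MeasurableSpace (MatTuple F m η ℓ) := ⊤
  (Measure.pi fun _ : Fin γ => uniformOn (sumRankBall (0 : MatTuple F m η ℓ) r)).real E

/-! Write n = ηℓ, q = |F|, and let B be the ball. The heart is a two-point estimate,
`exists_card_pair_le`: for nonzero α, α' and any shift b, independent uniform X, Y in B satisfy αX +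
α'Y + b ∈ B with probability at most q^(-δmn).

For one block it rests on a double count. If G spans part of ker(X + a) and the functionals H vanish
on range X, then H(aG) = 0. When a has large rank this bilinear condition makes pairs (G, H) rare,
so few X have both X and X + a of low rank. The resulting exponent is a concave quadratic in the two
rank bounds. Replacing it by its tangent plane at (ρη, ρη) lets the block bounds be multiplied using
only the total ranks, and the result matches |B| up to q^(O(mℓ)), with a saving of order η² for each
block where a has large rank. In the two-point estimate the translation is a(X) = α'⁻¹(αX + b).
Either it has weight above ρn/2, hence many large blocks, or it lies in the ball of radius ρn/2,
which is exponentially smaller than B.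

The rest is combinatorial. If the span meets B in at least q^(2d)γ points, the coefficient vectors
contain a chain v_1, ..., v_d and a base w such that each v_j - w has two nonzero coordinates at
which all later differences vanish (`exists_isTwoChain`). With Σ w_t X_t replaced by a fixed y,
resampling these two coordinates for each j in turn gives probability at most q^(-dδmn). A union
bound over chains costs q^(γ(d+1)), which is q^(o(mn)), and over y costs q^(mn). Taking dδ ≥ 4
leaves q^(-(3-o(1))mn), with K = q^(2d). -/

/-! ### Counting preliminaries -/

open Module in
/-- The number of linearly independent `d`-families in a space of dimension at least `d`. -/
theorem pow_le_card_linearIndependent {F V : Type*} [Field F] [Finite F] [AddCommGroup V]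
    [Module F V] [FiniteDimensional F V] {d n : ℕ} (hd : d ≤ n) (hn : n ≤ finrank F V) :
    Nat.card F ^ ((n - 1) * d) ≤ Nat.card {s : Fin d → V // LinearIndependent F s} := by
  classical
  have := Fintype.ofFinite F
  have hq : 2 ≤ Fintype.card F := Fintype.one_lt_card
  have hV : Finite V := Module.finite_of_finite F
  have := Fintype.ofFinite V
  rw [card_linearIndependent (hd.trans hn), pow_mul, Nat.card_eq_fintype_card]
  calc (Fintype.card F ^ (n - 1)) ^ d = ∏ i : Fin d, Fintype.card F ^ (n - 1) := by simp
    _ ≤ _ := by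
      refine Finset.prod_le_prod' fun i _ => ?_
      have hi := i.2
      -- As q ≥ 2, removing q^i ≤ q^N from q^(N+1) leaves at least q^N ≥ q^(n-1).
      obtain ⟨N, hN⟩ : ∃ N, finrank F V = N + 1 := ⟨finrank F V - 1, by omega⟩
      rw [hN, pow_succ]
      have h1 : Fintype.card F ^ (i : ℕ) ≤ Fintype.card F ^ N :=
        Nat.pow_le_pow_right (by omega) (by omega)
      have h2 : Fintype.card F ^ (n - 1) ≤ Fintype.card F ^ N :=
        Nat.pow_le_pow_right (by omega) (by omega)
      have h3 : Fintype.card F ^ N * 2 ≤ Fintype.card F ^ N * Fintype.card F :=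
        Nat.mul_le_mul_left _ hq
      omega

theorem card_subtype_prod {A B : Type*} [Fintype A] [Finite B] (P : A → B → Prop) :
    Nat.card {p : A × B // P p.1 p.2} = ∑ a, Nat.card {b // P a b} := by
  rw [Nat.card_congr (Equiv.subtypeProdEquivSigmaSubtype P), Nat.card_sigma]

theorem card_subtype_prod_le {A B : Type*} [Finite A] [Finite B] (P : A → B → Prop) (k : ℕ)
    (h : ∀ a, Nat.card {b // P a b} ≤ k) :
    Nat.card {p : A × B // P p.1 p.2} ≤ Nat.card A * k := by
  have := Fintype.ofFinite A
  rw [card_subtype_prod, Nat.card_eq_fintype_card]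
  simpa using Finset.sum_le_card_nsmul Finset.univ _ k fun a _ => h a

theorem le_card_subtype_prod {A B : Type*} [Finite A] [Finite B] (P : A → B → Prop) (k : ℕ)
    (h : ∀ a, k ≤ Nat.card {b // P a b}) :
    Nat.card A * k ≤ Nat.card {p : A × B // P p.1 p.2} := by
  have := Fintype.ofFinite A
  rw [card_subtype_prod, Nat.card_eq_fintype_card]
  simpa using Finset.card_nsmul_le_sum Finset.univ _ k fun a _ => h a

/-! ### Linear maps X with X and X + a both of low rank -/

section Blocks

open Module

variable {F V W : Type*} [Field F] [Finite F] [AddCommGroup V] [Module F V]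
  [FiniteDimensional F V] [AddCommGroup W] [Module F W] [FiniteDimensional F W]

theorem finite_linearMap : Finite (V →ₗ[F] W) :=
  Module.finite_of_finite F

/-- Two such maps differ by a map that kills G and takes values in K, that is, by an element of
Hom(V/G, K). -/
theorem card_linearMap_fixed_le (G : Submodule F V) (K : Submodule F W) (b : V →ₗ[F] W) :
    Nat.card {X : V →ₗ[F] W // LinearMap.range X ≤ K ∧ ∀ v ∈ G, X v = b v} ≤
      Nat.card F ^ (finrank F (V ⧸ G) * finrank F K) := by
  have : Finite (V →ₗ[F] W) := finite_linearMap
  have : Finite ((V ⧸ G) →ₗ[F] K) := finite_linearMap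
  rcases isEmpty_or_nonempty {X : V →ₗ[F] W // LinearMap.range X ≤ K ∧ ∀ v ∈ G, X v = b v}
    with he | ⟨⟨X₀, hX₀, hb₀⟩⟩
  · simp
  rw [← finrank_linearMap F F (V ⧸ G) K, ← Module.natCard_eq_pow_finrank]
  have hm : ∀ X : {X : V →ₗ[F] W // LinearMap.range X ≤ K ∧ ∀ v ∈ G, X v = b v},
      ∀ v, (X.1 - X₀) v ∈ K := fun X v =>
    K.sub_mem (X.2.1 ⟨v, rfl⟩) (hX₀ ⟨v, rfl⟩)
  have hk : ∀ X : {X : V →ₗ[F] W // LinearMap.range X ≤ K ∧ ∀ v ∈ G, X v = b v},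
      G ≤ LinearMap.ker ((X.1 - X₀).codRestrict K (hm X)) := by
    intro X v hv
    rw [LinearMap.mem_ker]
    ext
    simp [X.2.2 v hv, hb₀ v hv]
  refine Nat.card_le_card_of_injective
    (fun X => G.liftQ ((X.1 - X₀).codRestrict K (hm X)) (hk X)) ?_
  intro X Y h
  ext v
  have := congrArg (fun f => ((f (G.mkQ v) : K) : W)) h
  simpa using this

/-- Families `G` of vectors whose image under `a` has rank at most `w`. -/
theorem card_family_image_rank_le (a : V →ₗ[F] W) (d w : ℕ) :
    Nat.card {G : Fin d → V // finrank F (Submodule.span F (Set.range (a ∘ G))) ≤ w} ≤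
      Nat.card F ^ (d * w + finrank F V * w + finrank F (LinearMap.ker a) * d) := by
  have hV : Finite V := Module.finite_of_finite F
  have : Nat.card F ^ (d * w + finrank F V * w + finrank F (LinearMap.ker a) * d) =
      Nat.card ((Fin d → Fin w → F) × (Fin w → V) × (Fin d → LinearMap.ker a)) := by
    simp only [Nat.card_prod, Nat.card_fun, Nat.card_fin, pow_add, pow_mul,
      Module.natCard_eq_pow_finrank (K := F) (V := V),
      Module.natCard_eq_pow_finrank (K := F) (V := LinearMap.ker a)]
    rw [pow_right_comm, mul_assoc]
  rw [this]
  -- G is encoded by lifts of a basis of the span of its image (padded with zeros to length w), the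
  -- coordinates of each a(G i) in it, and a correction in ker a.
  have key : ∀ G : {G : Fin d → V // finrank F (Submodule.span F (Set.range (a ∘ G))) ≤ w},
      ∃ p : (Fin d → Fin w → F) × (Fin w → V) × (Fin d → LinearMap.ker a),
        ∀ i, G.1 i = ∑ k, p.1 i k • p.2.1 k + p.2.2 i := by
    rintro ⟨G, hG⟩
    set S := Submodule.span F (Set.range (a ∘ G)) with hS
    have hSr : S ≤ LinearMap.range a := by
      rw [hS, Submodule.span_le]
      rintro _ ⟨i, rfl⟩
      exact ⟨G i, rfl⟩
    let B := Module.finBasis F S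
    choose g hg using fun k : Fin (finrank F S) => hSr (B k).2
    let g' : Fin w → V := fun k => if h : (k : ℕ) < finrank F S then g ⟨k, h⟩ else 0
    have hc : ∀ i, ∃ c : Fin w → F, a (G i) = ∑ k, c k • a (g' k) := by
      intro i
      have hi : a (G i) ∈ S := Submodule.subset_span ⟨i, rfl⟩
      have hle : S ≤ Submodule.span F (Set.range (a ∘ g')) := by
        intro x hx
        have := B.sum_repr ⟨x, hx⟩
        have h2 := congrArg Subtype.val this
        simp only [Submodule.coe_sum, Submodule.coe_smul] at h2
        rw [← h2]
        refine Submodule.sum_mem _ fun k _ => Submodule.smul_mem _ _ ?_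
        refine Submodule.subset_span ⟨⟨k, k.2.trans_le hG⟩, ?_⟩
        simp [g', hg]
      have h3 := hle hi
      rw [Submodule.mem_span_range_iff_exists_fun] at h3
      obtain ⟨c, hc⟩ := h3
      exact ⟨c, hc.symm⟩
    choose c hc using hc
    refine ⟨⟨c, g', fun i => ⟨G i - ∑ k, c i k • g' k, ?_⟩⟩, fun i => by simp⟩
    simp [LinearMap.mem_ker, hc i]
  choose p hp using key
  refine Nat.card_le_card_of_injective p ?_
  intro G G' h
  ext i
  rw [hp G i, hp G' i, h]

omit [Finite F] in
/-- Families of functionals vanishing on a subspace. -/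
theorem card_family_dualAnnihilator (U : Submodule F W) (e : ℕ) :
    Nat.card {H : Fin e → Dual F W // ∀ i, H i ∈ U.dualAnnihilator} =
      Nat.card F ^ ((finrank F W - finrank F U) * e) := by
  rw [Nat.card_congr (Equiv.subtypePiEquivPi (p := fun _ x => x ∈ U.dualAnnihilator)), Nat.card_pi]
  have := Subspace.finrank_add_finrank_dualAnnihilator_eq U
  have h2 : finrank F U.dualAnnihilator = finrank F W - finrank F U := by omega
  have h3 : Nat.card {x // x ∈ U.dualAnnihilator} = Nat.card F ^ (finrank F W - finrank F U) := by
    rw [← h2, Module.natCard_eq_pow_finrank (K := F)]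
  simp only [h3, pow_mul, Finset.prod_const, Finset.card_univ, Fintype.card_fin]

/-- The two terms split on the dimension of the span of a ∘ G. If it is at most w, such G are few
and H is arbitrary; if it exceeds w, the functionals are confined to an annihilator of dimension
below dim W - w. -/
theorem card_bilinear_vanishing_le (a : V →ₗ[F] W) (d e w : ℕ) :
    Nat.card {p : (Fin d → V) × (Fin e → Dual F W) // ∀ i j, p.2 j (a (p.1 i)) = 0} ≤
      Nat.card F ^ (d * w + finrank F V * w + finrank F (LinearMap.ker a) * d + finrank F W * e) +
      Nat.card F ^ (finrank F V * d + (finrank F W - w) * e) := by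
  classical
  have hV : Finite V := Module.finite_of_finite F
  have hW : Finite (Dual F W) := Module.finite_of_finite F
  have := Fintype.ofFinite V
  have hF : 0 < Nat.card F := Nat.card_pos
  let S : (Fin d → V) → Submodule F W := fun G => Submodule.span F (Set.range (a ∘ G))
  have h0 : ∀ G : Fin d → V, Nat.card {H : Fin e → Dual F W // ∀ i j, H j (a (G i)) = 0} =
      Nat.card F ^ ((finrank F W - finrank F (S G)) * e) := by
    intro G
    rw [← card_family_dualAnnihilator]
    refine Nat.card_congr (Equiv.subtypeEquivRight fun H => ?_)
    constructor
    · intro h j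
      rw [Submodule.mem_dualAnnihilator]
      intro x hx
      induction hx using Submodule.span_induction with
      | mem x hx => obtain ⟨i, rfl⟩ := hx; exact h i j
      | zero => simp
      | add x y _ _ hx hy => simp [hx, hy]
      | smul c x _ hx => simp [hx]
    · intro h i j
      exact (Submodule.mem_dualAnnihilator _).1 (h j) _ (Submodule.subset_span ⟨i, rfl⟩)
  refine (card_subtype_prod
    (fun (G : Fin d → V) (H : Fin e → Dual F W) => ∀ i j, H j (a (G i)) = 0)).trans_le ?_
  simp only [h0]
  calc ∑ G, Nat.card F ^ ((finrank F W - finrank F (S G)) * e)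
      ≤ ∑ G, ((if finrank F (S G) ≤ w then Nat.card F ^ (finrank F W * e) else 0) +
          Nat.card F ^ ((finrank F W - w) * e)) := by
        refine Finset.sum_le_sum fun G _ => ?_
        split_ifs with h
        · refine le_add_right (Nat.pow_le_pow_right hF ?_)
          gcongr
          omega
        · rw [zero_add]
          refine Nat.pow_le_pow_right hF ?_
          gcongr
          omega
    _ = Nat.card {G : Fin d → V // finrank F (S G) ≤ w} * Nat.card F ^ (finrank F W * e) +
          Nat.card F ^ (finrank F V * d) * Nat.card F ^ ((finrank F W - w) * e) := by
        rw [Finset.sum_add_distrib, ← Finset.sum_filter, Finset.sum_const, Finset.sum_const,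
          Nat.subtype_card (Finset.univ.filter fun G => finrank F (S G) ≤ w) (by simp)]
        simp only [smul_eq_mul, Finset.card_univ, ← Nat.card_eq_fintype_card, Nat.card_fun,
          Nat.card_fin, Module.natCard_eq_pow_finrank (K := F) (V := V), pow_mul]
    _ ≤ _ := by
        rw [pow_add _ _ (finrank F W * e), pow_add _ (finrank F V * d)]
        gcongr
        exact card_family_image_rank_le a d w

omit [Finite F] in
theorem finrank_dualCoannihilator_span {e : ℕ} {H : Fin e → Dual F W}
    (hH : LinearIndependent F H) :
    finrank F (Submodule.span F (Set.range H)).dualCoannihilator = finrank F W - e := by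
  have := Subspace.finrank_add_finrank_dualCoannihilator_eq (Submodule.span F (Set.range H))
  rw [finrank_span_eq_card hH, Fintype.card_fin] at this
  omega

/-- Double counting of the `X` with `rank X ≤ r` and `rank (X + a) ≤ t` through vectors
in the kernel of `X + a` and functionals vanishing on the range of `X`. -/
theorem card_rank_le_mul_le (a : V →ₗ[F] W) {r t : ℕ} (hr : r ≤ finrank F W)
    (ht : t ≤ finrank F V) (w : ℕ) :
    Nat.card {X : V →ₗ[F] W // finrank F (LinearMap.range X) ≤ r ∧
        finrank F (LinearMap.range (X + a)) ≤ t} *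
      (Nat.card F ^ ((finrank F V - t - 1) * (finrank F V - t)) *
        Nat.card F ^ ((finrank F W - r - 1) * (finrank F W - r))) ≤
    (Nat.card F ^ ((finrank F V - t) * w + finrank F V * w +
        finrank F (LinearMap.ker a) * (finrank F V - t) + finrank F W * (finrank F W - r)) +
      Nat.card F ^ (finrank F V * (finrank F V - t) + (finrank F W - w) * (finrank F W - r))) *
      Nat.card F ^ (t * r) := by
  have hV : Finite V := Module.finite_of_finite F
  have hW : Finite (Dual F W) := Module.finite_of_finite F
  have hVW : Finite (V →ₗ[F] W) := finite_linearMap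
  set d := finrank F V - t with hd
  set e := finrank F W - r with he
  let N := {X : V →ₗ[F] W // finrank F (LinearMap.range X) ≤ r ∧
        finrank F (LinearMap.range (X + a)) ≤ t}
  let P : N → (Fin d → V) × (Fin e → Dual F W) → Prop := fun X p =>
    (LinearIndependent F p.1 ∧ ∀ i, (X.1 + a) (p.1 i) = 0) ∧
    (LinearIndependent F p.2 ∧ ∀ j v, p.2 j (X.1 v) = 0)
  have hlow : ∀ X : N, Nat.card F ^ ((d - 1) * d) * Nat.card F ^ ((e - 1) * e) ≤
      Nat.card {p // P X p} := by
    intro X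
    have h1 : d ≤ finrank F (LinearMap.ker (X.1 + a)) := by
      have := LinearMap.finrank_range_add_finrank_ker (X.1 + a)
      have := X.2.2
      omega
    have h2 : e ≤ finrank F (LinearMap.range X.1).dualAnnihilator := by
      have := Subspace.finrank_add_finrank_dualAnnihilator_eq (LinearMap.range X.1)
      have := X.2.1
      omega
    refine (Nat.mul_le_mul (pow_le_card_linearIndependent le_rfl h1)
      (pow_le_card_linearIndependent (V := (LinearMap.range X.1).dualAnnihilator) le_rfl h2)).trans ?_
    rw [← Nat.card_prod]
    refine Nat.card_le_card_of_injective (fun s => ⟨(fun i => (s.1.1 i : V),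
      fun j => (s.2.1 j : Dual F W)), ⟨⟨?_, ?_⟩, ?_, ?_⟩⟩) ?_
    · exact s.1.2.map' (Submodule.subtype _) (Submodule.ker_subtype _)
    · intro i
      exact (s.1.1 i).2
    · exact s.2.2.map' (Submodule.subtype _) (Submodule.ker_subtype _)
    · intro j v
      exact (Submodule.mem_dualAnnihilator _).1 (s.2.1 j).2 _ ⟨v, rfl⟩
    · rintro ⟨⟨s, hs⟩, ⟨u, hu⟩⟩ ⟨⟨s', hs'⟩, ⟨u', hu'⟩⟩ h
      simp only [Subtype.mk.injEq, Prod.mk.injEq] at h ⊢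
      exact ⟨funext fun i => Subtype.ext (congrFun h.1 i),
        funext fun i => Subtype.ext (congrFun h.2 i)⟩
  refine (le_card_subtype_prod P _ hlow).trans ?_
  -- Counting the incidences from the other side: H kills X(G) and X + a kills G, so H(aG) = 0, a
  -- condition free of X.
  let Q := {p : (Fin d → V) × (Fin e → Dual F W) // ∀ i j, p.2 j (a (p.1 i)) = 0}
  let R : Q → (V →ₗ[F] W) → Prop := fun p X =>
    LinearIndependent F p.1.1 ∧ LinearIndependent F p.1.2 ∧
      (∀ i, (X + a) (p.1.1 i) = 0) ∧ ∀ j v, p.1.2 j (X v) = 0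
  have hle : Nat.card {x : N × ((Fin d → V) × (Fin e → Dual F W)) // P x.1 x.2} ≤
      Nat.card {y : Q × (V →ₗ[F] W) // R y.1 y.2} := by
    refine Nat.card_le_card_of_injective (fun x => ⟨(⟨x.1.2, ?_⟩, x.1.1.1), ?_⟩) ?_
    · intro i j
      have h1 := x.2.1.2 i
      have h2 := x.2.2.2 j (x.1.2.1 i)
      have h3 := congrArg (x.1.2.2 j) h1
      simpa [h2] using h3
    · exact ⟨x.2.1.1, x.2.2.1, x.2.1.2, x.2.2.2⟩
    · rintro ⟨⟨⟨X, hX⟩, p⟩, hx⟩ ⟨⟨⟨X', hX'⟩, p'⟩, hx'⟩ h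
      simp only [Subtype.mk.injEq, Prod.mk.injEq] at h ⊢
      exact ⟨Subtype.ext h.2, congrArg Subtype.val h.1⟩
  refine hle.trans ((card_subtype_prod_le R (Nat.card F ^ (t * r)) ?_).trans
    (Nat.mul_le_mul_right _ (card_bilinear_vanishing_le a d e w)))
  intro p
  by_cases hp : LinearIndependent F p.1.1 ∧ LinearIndependent F p.1.2
  swap
  · have : IsEmpty {b // R p b} := ⟨fun b => hp ⟨b.2.1, b.2.2.1⟩⟩
    simp
  have hG : finrank F (V ⧸ Submodule.span F (Set.range p.1.1)) = t := by
    rw [Submodule.finrank_quotient, finrank_span_eq_card hp.1, Fintype.card_fin]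
    omega
  have hK := finrank_dualCoannihilator_span hp.2
  have hK' : finrank F W - e = r := by omega
  -- Given (G, H), the map X equals -a on the span of G, of codimension t, and maps into the common
  -- kernel of H, of dimension r.
  have := card_linearMap_fixed_le (Submodule.span F (Set.range p.1.1))
    (Submodule.span F (Set.range p.1.2)).dualCoannihilator (-a)
  rw [hG, hK, hK'] at this
  refine le_trans ?_ this
  refine Nat.card_le_card_of_injective (fun X => ⟨X.1, ?_, ?_⟩) ?_
  · rintro _ ⟨v, rfl⟩
    rw [Submodule.mem_dualCoannihilator]
    intro φ hφ
    induction hφ using Submodule.span_induction with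
    | mem x hx => obtain ⟨j, rfl⟩ := hx; exact X.2.2.2.2 j v
    | zero => simp
    | add x y _ _ hx hy => simp [hx, hy]
    | smul c x _ hx => simp [hx]
  · intro v hv
    induction hv using Submodule.span_induction with
    | mem x hx =>
      obtain ⟨i, rfl⟩ := hx
      have := X.2.2.2.1 i
      simpa using eq_neg_of_add_eq_zero_left this
    | zero => simp
    | add x y _ _ hx hy => simp only [map_add, hx, hy]
    | smul c x _ hx => simp only [map_smul, hx]
  · intro X Y h
    exact Subtype.ext (congrArg (fun Z => Z.1) h)

/-- A lower bound for the number of linear maps of rank at most `R`. -/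
theorem pow_le_card_rank_le {R k : ℕ} (hV : finrank F V = R + k) (hW : R ≤ finrank F W) :
    Nat.card F ^ ((finrank F W - 1) * R + k * R) ≤
      Nat.card {X : V →ₗ[F] W // finrank F (LinearMap.range X) ≤ R} := by
  have hVW : Finite (V →ₗ[F] W) := finite_linearMap
  let ε : V ≃ₗ[F] (Fin R → F) × (Fin k → F) := LinearEquiv.ofFinrankEq _ _ (by simp [hV])
  have hT : Nat.card F ^ (k * R) = Nat.card ((Fin k → F) →ₗ[F] (Fin R → F)) := by
    rw [Module.natCard_eq_pow_finrank (K := F) (V := (Fin k → F) →ₗ[F] (Fin R → F)),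
      finrank_linearMap, finrank_fin_fun, finrank_fin_fun]
  rw [pow_add, hT]
  refine (Nat.mul_le_mul_right _ (pow_le_card_linearIndependent (V := W) hW le_rfl)).trans ?_
  rw [← Nat.card_prod]
  -- The pair (s, T) goes to (x, y) ↦ Σ s_i (x + Ty)_i. Setting y = 0 recovers s, and independence
  -- of s then recovers T.
  refine Nat.card_le_card_of_injective (fun p => ⟨((Fintype.linearCombination F p.1.1).comp
    (LinearMap.coprod LinearMap.id p.2)).comp ε.toLinearMap, ?_⟩) ?_
  · rw [LinearMap.comp_assoc]
    refine (Submodule.finrank_mono (LinearMap.range_comp_le_range _ _)).trans ?_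
    refine (LinearMap.finrank_range_le _).trans (by simp)
  · rintro ⟨⟨s, hs⟩, T⟩ ⟨⟨s', hs'⟩, T'⟩ h
    have h1 : ∀ x y, Fintype.linearCombination F s (x + T y) =
        Fintype.linearCombination F s' (x + T' y) := by
      intro x y
      have := congrArg (fun f => f.1 (ε.symm (x, y))) h
      simpa using this
    have h2 : s = s' := by
      ext i
      classical
      have := h1 (Pi.single i 1) 0
      simpa [Fintype.linearCombination_apply_single] using this
    subst h2
    have h3 : T = T' := by
      refine LinearMap.ext fun y => ?_
      have := h1 0 y
      rw [zero_add, zero_add] at this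
      exact (LinearIndependent.fintypeLinearCombination_injective hs) this
    rw [h3]

end Blocks

/-! ### The block estimate with real exponents and its tangent-plane form -/

section

open Module

variable {F V W : Type*} [Field F] [Finite F] [AddCommGroup V] [Module F V]
  [FiniteDimensional F V] [AddCommGroup W] [Module F W] [FiniteDimensional F W]

theorem two_le_natCard_field (F : Type*) [Field F] [Finite F] : (2 : ℝ) ≤ Nat.card F := by
  exact_mod_cast Finite.one_lt_card (α := F)

/-- Δ is the saving: `h1` and `h2` bound the two terms of the double count by the same power of q.
The summand 1 pays for adding two terms, as 2 ≤ q; the codimensions η - t and m - r pay for the loss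
in counting independent families. -/
theorem card_rank_le_rpow (a : V →ₗ[F] W) {r t : ℕ} (hr : r ≤ finrank F W)
    (ht : t ≤ finrank F V) {w : ℕ} (hw : w ≤ finrank F W) {Δ : ℝ}
    (h1 : Δ ≤ finrank F (LinearMap.range a) * (finrank F V - t : ℝ) -
      (finrank F V - t + finrank F V) * w)
    (h2 : Δ ≤ w * (finrank F W - r : ℝ)) :
    (Nat.card {X : V →ₗ[F] W // finrank F (LinearMap.range X) ≤ r ∧
        finrank F (LinearMap.range (X + a)) ≤ t} : ℝ) ≤
      (Nat.card F : ℝ) ^ ((r * t + (finrank F V - t) * t + (finrank F W - r) * r : ℝ) +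
        (finrank F V - t) + (finrank F W - r) + 1 - Δ) := by
  have hq := two_le_natCard_field F
  have hq0 : (0 : ℝ) < Nat.card F := by linarith
  have key := card_rank_le_mul_le a hr ht w
  have hker := LinearMap.finrank_range_add_finrank_ker a
  set N := Nat.card {X : V →ₗ[F] W // finrank F (LinearMap.range X) ≤ r ∧
        finrank F (LinearMap.range (X + a)) ≤ t}
  obtain ⟨d, hd⟩ := Nat.exists_eq_add_of_le ht
  obtain ⟨e, he⟩ := Nat.exists_eq_add_of_le hr
  obtain ⟨v, hv⟩ := Nat.exists_eq_add_of_le hw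
  have hd' : finrank F V - t = d := by omega
  have he' : finrank F W - r = e := by omega
  have hv' : finrank F W - w = v := by omega
  rw [hd', he', hv'] at key
  have hvR : (v : ℝ) = finrank F W - w := by rw [hv]; push_cast; ring
  have hdR : (finrank F V : ℝ) - t = d := by rw [hd]; push_cast; ring
  have heR : (finrank F W : ℝ) - r = e := by rw [he]; push_cast; ring
  have hkR : (finrank F (LinearMap.ker a) : ℝ) = finrank F V - finrank F (LinearMap.range a) := by
    rw [← hker]; push_cast; ring
  rw [hdR] at h1
  rw [heR] at h2
  rw [hdR, heR]
  have hpred : ∀ n : ℕ, (n : ℝ) * n - n ≤ (((n - 1) * n : ℕ) : ℝ) := by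
    intro n
    rcases n with _ | n
    · simp
    · push_cast [Nat.add_sub_cancel]
      nlinarith
  have key' : (N : ℝ) * ((Nat.card F : ℝ) ^ (((d - 1) * d : ℕ) : ℝ) *
      (Nat.card F : ℝ) ^ (((e - 1) * e : ℕ) : ℝ)) ≤
      ((Nat.card F : ℝ) ^ ((d * w + finrank F V * w + finrank F (LinearMap.ker a) * d +
        finrank F W * e : ℕ) : ℝ) + (Nat.card F : ℝ) ^ ((finrank F V * d + v * e : ℕ) : ℝ)) *
      (Nat.card F : ℝ) ^ ((t * r : ℕ) : ℝ) := by
    simp only [Real.rpow_natCast]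
    exact_mod_cast key
  rw [← Real.rpow_add hq0] at key'
  have hDE : (0 : ℝ) < (Nat.card F : ℝ) ^ ((((d - 1) * d : ℕ) : ℝ) + (((e - 1) * e : ℕ) : ℝ)) :=
    Real.rpow_pos_of_pos hq0 _
  refine le_of_mul_le_mul_right (key'.trans ?_) hDE
  rw [← Real.rpow_add hq0]
  have hM : ∀ x, x ≤ (finrank F V * d + finrank F W * e : ℝ) - Δ →
      (Nat.card F : ℝ) ^ x ≤ (Nat.card F : ℝ) ^ ((finrank F V * d + finrank F W * e : ℝ) - Δ) :=
    fun x hx => Real.rpow_le_rpow_of_exponent_le (by linarith) hx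
  have e1 := hM ((d * w + finrank F V * w + finrank F (LinearMap.ker a) * d +
        finrank F W * e : ℕ) : ℝ) (by push_cast; rw [hkR]; linarith)
  have e2 := hM ((finrank F V * d + v * e : ℕ) : ℝ) (by push_cast; rw [hvR]; linarith)
  calc _ ≤ (Nat.card F : ℝ) ^ (1 : ℝ) *
        (Nat.card F : ℝ) ^ ((finrank F V * d + finrank F W * e : ℝ) - Δ) *
        (Nat.card F : ℝ) ^ ((t * r : ℕ) : ℝ) := by
        refine mul_le_mul_of_nonneg_right ?_ (by positivity)
        have h0 : 0 < (Nat.card F : ℝ) ^ ((finrank F V * d + finrank F W * e : ℝ) - Δ) :=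
          Real.rpow_pos_of_pos hq0 _
        rw [Real.rpow_one]
        nlinarith
    _ = (Nat.card F : ℝ) ^ (1 + ((finrank F V * d + finrank F W * e : ℝ) - Δ) +
          ((t * r : ℕ) : ℝ)) := by rw [Real.rpow_add hq0, Real.rpow_add hq0]
    _ ≤ _ := by
        refine Real.rpow_le_rpow_of_exponent_le (by linarith) ?_
        have := hpred d
        have := hpred e
        have hV : (finrank F V : ℝ) = t + d := by rw [hd]; push_cast; ring
        have hW : (finrank F W : ℝ) = r + e := by rw [he]; push_cast; ring
        rw [hV, hW]
        push_cast at *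
        nlinarith

/-- The exponent of the block estimate: the tangent plane at `(ρη, ρη)` of the exponent
`r t + (η - t) t + (m - r) r`. -/
noncomputable def tangentExponent (m η ρ r t : ℝ) : ℝ :=
  (m + η - ρ * η) * (ρ * η) + (m - ρ * η) * (r - ρ * η) + (η - ρ * η) * (t - ρ * η)

-- With x = r - ρη and y = t - ρη, the quadratic exponent is its tangent plane minus the positive
-- definite form x² - xy + y². Let κ = (1 - ρ)/2. If r or t is at least (1 - κ)η, this form alone
-- supplies the saving; otherwise η - t and m - r are at least κη and the rank of a supplies it.
open Classical in
theorem card_rank_le_tangent (a : V →ₗ[F] W) (hVW : finrank F V ≤ finrank F W)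
    {ρ ε : ℝ} (hρ0 : 0 ≤ ρ) (hρ1 : ρ ≤ 1) (hε0 : 0 ≤ ε) (hε1 : ε ≤ 1) {r t : ℕ}
    (hr : r ≤ finrank F V) (ht : t ≤ finrank F V) :
    (Nat.card {X : V →ₗ[F] W // finrank F (LinearMap.range X) ≤ r ∧
        finrank F (LinearMap.range (X + a)) ≤ t} : ℝ) ≤
      (Nat.card F : ℝ) ^ (tangentExponent (finrank F W) (finrank F V) ρ r t +
        3 * finrank F W + 1 - if ε * finrank F V ≤ finrank F (LinearMap.range a) then
          ε * ((1 - ρ) / 2) ^ 2 / 4 * (finrank F V : ℝ) ^ 2 else 0) := by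
  have hq := two_le_natCard_field F
  have hmη : (finrank F V : ℝ) ≤ finrank F W := by exact_mod_cast hVW
  have hrη : (r : ℝ) ≤ finrank F V := by exact_mod_cast hr
  have htη : (t : ℝ) ≤ finrank F V := by exact_mod_cast ht
  have hr0 : (0 : ℝ) ≤ r := by positivity
  have ht0 : (0 : ℝ) ≤ t := by positivity
  have hη0 : (0 : ℝ) ≤ finrank F V := by positivity
  have hm1 := hr.trans hVW
  set m := (finrank F W : ℝ) with hm
  set η := (finrank F V : ℝ) with hη
  set κ := (1 - ρ) / 2 with hκ
  have hκ0 : 0 ≤ κ := by rw [hκ]; linarith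
  have hκ1 : κ ≤ 1 / 2 := by rw [hκ]; linarith
  have hE : (r * t + (η - t) * t + (m - r) * r : ℝ) = tangentExponent m η ρ r t -
      ((r - ρ * η) ^ 2 - (r - ρ * η) * (t - ρ * η) + (t - ρ * η) ^ 2) := by
    simp only [tangentExponent]
    ring
  have hmono : ∀ x y : ℝ, x ≤ y → (Nat.card F : ℝ) ^ x ≤ (Nat.card F : ℝ) ^ y :=
    fun x y h => Real.rpow_le_rpow_of_exponent_le (by linarith) h
  have hQ : 0 ≤ (r - ρ * η) ^ 2 - (r - ρ * η) * (t - ρ * η) + (t - ρ * η) ^ 2 := by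
    nlinarith [sq_nonneg ((r - ρ * η) - (t - ρ * η)), sq_nonneg (r - ρ * η),
      sq_nonneg (t - ρ * η)]
  -- With w = 0 and Δ = 0 this is the bound that ignores a.
  have triv := card_rank_le_rpow a hm1 ht (w := 0) (Δ := 0) (Nat.zero_le _)
    (by push_cast; rw [mul_zero, sub_zero]; exact mul_nonneg (by positivity) (by linarith))
    (by simp)
  split_ifs with hs
  swap
  · refine triv.trans (hmono _ _ ?_)
    rw [hE]
    linarith
  have hc : ε * κ ^ 2 / 4 ≤ 3 / 4 * κ ^ 2 := by
    nlinarith only [mul_le_mul_of_nonneg_right hε1 (sq_nonneg κ), sq_nonneg κ]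
  have hcη : ε * κ ^ 2 / 4 * η ^ 2 ≤ 3 / 4 * (κ * η) ^ 2 := by
    rw [mul_pow, ← mul_assoc]
    exact mul_le_mul_of_nonneg_right hc (sq_nonneg η)
  by_cases h1 : (1 - κ) * η ≤ r
  · refine triv.trans (hmono _ _ ?_)
    rw [hE]
    have : κ * η ≤ r - ρ * η := by
      have : (1 - κ) * η = κ * η + ρ * η := by rw [hκ]; ring
      linarith
    have h2 : (κ * η) ^ 2 ≤ (r - ρ * η) ^ 2 := pow_le_pow_left₀ (by positivity) this 2
    nlinarith only [sq_nonneg ((r - ρ * η) - 2 * (t - ρ * η)), h2, hcη, hmη, hr0, ht0, hrη, htη, hη0]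
  by_cases h2 : (1 - κ) * η ≤ t
  · refine triv.trans (hmono _ _ ?_)
    rw [hE]
    have : κ * η ≤ t - ρ * η := by
      have : (1 - κ) * η = κ * η + ρ * η := by rw [hκ]; ring
      linarith
    have h2 : (κ * η) ^ 2 ≤ (t - ρ * η) ^ 2 := pow_le_pow_left₀ (by positivity) this 2
    nlinarith only [sq_nonneg (2 * (r - ρ * η) - (t - ρ * η)), h2, hcη, hmη, hr0, ht0, hrη, htη, hη0]
  push Not at h1 h2
  have hw1 := Nat.floor_le (a := ε * κ * η / 4) (by positivity)
  have hw2 := Nat.lt_floor_add_one (ε * κ * η / 4)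
  set w := ⌊ε * κ * η / 4⌋₊ with hw
  have hεκ : ε * κ ≤ 1 / 2 := by
    simpa using mul_le_mul hε1 hκ1 hκ0 zero_le_one
  have hwm : w ≤ finrank F W := by
    have := mul_le_mul_of_nonneg_right hεκ hη0
    have : (w : ℝ) ≤ m := by linarith
    rw [hm] at this
    exact_mod_cast this
  have hd : κ * η ≤ η - t := by linarith
  have he : κ * η ≤ m - r := by linarith
  have hκη : 0 ≤ κ * η := by positivity
  -- The choice w ≈ εκη/4 uses up at most half of the gain εκη² from rank a. The term -η in Δ covers
  -- the rounding of w and is absorbed by 3m.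
  have := card_rank_le_rpow a hm1 ht (w := w) (Δ := ε * κ ^ 2 / 4 * η ^ 2 - η) hwm ?_ ?_
  · refine this.trans (hmono _ _ ?_)
    rw [hE]
    linarith
  · rw [← hη]
    have hsd : ε * η * (κ * η) ≤ finrank F (LinearMap.range a) * (η - t) :=
      mul_le_mul hs hd hκη (by positivity)
    have hdw : (η - t + η) * w ≤ (2 * η) * (ε * κ * η / 4) :=
      mul_le_mul (by linarith) hw1 (by positivity) (by linarith)
    have hx : 0 ≤ ε * κ * η ^ 2 := by positivity
    have := mul_le_mul_of_nonneg_left hκ1 hx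
    linarith
  · rw [← hm]
    have : (ε * κ * η / 4 - 1) * (κ * η) ≤ w * (m - r) := by
      refine (mul_le_mul_of_nonneg_right (by linarith) hκη).trans
        (mul_le_mul_of_nonneg_left he (by positivity))
    have := mul_le_mul_of_nonneg_right hκ1 hη0
    linarith

/-- Rounding ρη down to an integer R costs at most m + η in the exponent and the count of
independent families costs R ≤ η, together at most 3m. -/
theorem rpow_le_card_rank_le (hVW : finrank F V ≤ finrank F W) {ρ : ℝ} (hρ0 : 0 ≤ ρ)
    (hρ1 : ρ ≤ 1) :
    (Nat.card F : ℝ) ^ ((finrank F W + finrank F V - ρ * finrank F V) * (ρ * finrank F V) -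
        3 * finrank F W : ℝ) ≤
      Nat.card {X : V →ₗ[F] W // finrank F (LinearMap.range X) ≤ ⌊ρ * finrank F V⌋₊} := by
  have hq := two_le_natCard_field F
  have hmη : (finrank F V : ℝ) ≤ finrank F W := by exact_mod_cast hVW
  have hη0 : (0 : ℝ) ≤ finrank F V := by positivity
  have hR1 := Nat.floor_le (a := ρ * finrank F V) (by positivity)
  have hR2 := Nat.lt_floor_add_one (ρ * finrank F V)
  set R := ⌊ρ * finrank F V⌋₊
  have hRη : R ≤ finrank F V := by
    have : (R : ℝ) ≤ finrank F V := by nlinarith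
    exact_mod_cast this
  obtain ⟨k, hk⟩ := Nat.exists_eq_add_of_le hRη
  have key := pow_le_card_rank_le hk (hRη.trans hVW)
  have key' : (Nat.card F : ℝ) ^ (((finrank F W - 1) * R + k * R : ℕ) : ℝ) ≤
      Nat.card {X : V →ₗ[F] W // finrank F (LinearMap.range X) ≤ R} := by
    rw [Real.rpow_natCast]
    exact_mod_cast key
  refine le_trans (Real.rpow_le_rpow_of_exponent_le (by linarith) ?_) key'
  have h1 : ((finrank F W : ℝ) - 1) ≤ ((finrank F W - 1 : ℕ) : ℝ) := by
    have : finrank F W ≤ (finrank F W - 1) + 1 := by omega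
    have : (finrank F W : ℝ) ≤ ((finrank F W - 1 : ℕ) : ℝ) + 1 := by exact_mod_cast this
    linarith
  have hkR : (k : ℝ) = finrank F V - R := by rw [hk]; push_cast; ring
  have hRR : (R : ℝ) ≤ finrank F V := by exact_mod_cast hRη
  have hR0 : (0 : ℝ) ≤ R := by positivity
  have h3 := mul_le_mul_of_nonneg_right h1 hR0
  push_cast
  rw [hkR]
  set m := (finrank F W : ℝ)
  set η := (finrank F V : ℝ)
  have h4 : (m + η - ρ * η - R) * (ρ * η - R) ≤ (m + η) * 1 := by
    refine mul_le_mul (by nlinarith) (by linarith) (by linarith) (by linarith)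
  nlinarith

end

/-! ### From blocks to sum-rank balls -/

section

variable {F : Type*} [Field F] {m η ℓ : ℕ}

theorem rank_neg_matrix (A : Matrix (Fin m) (Fin η) F) : (-A).rank = A.rank := by
  have : (-A).mulVecLin = -A.mulVecLin := by
    ext
    simp
  rw [Matrix.rank, this, LinearMap.range_neg, Matrix.rank]

theorem rank_smul_matrix {c : F} (hc : c ≠ 0) (A : Matrix (Fin m) (Fin η) F) :
    (c • A).rank = A.rank := by
  have : (c • A).mulVecLin = c • A.mulVecLin := by
    ext
    simp
  rw [Matrix.rank, this, LinearMap.range_smul _ _ hc, Matrix.rank]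

theorem sumRankWeight_neg (X : MatTuple F m η ℓ) : sumRankWeight (-X) = sumRankWeight X := by
  simp [sumRankWeight, rank_neg_matrix]

theorem sumRankWeight_smul {c : F} (hc : c ≠ 0) (X : MatTuple F m η ℓ) :
    sumRankWeight (c • X) = sumRankWeight X := by
  simp [sumRankWeight, rank_smul_matrix hc]

theorem mem_sumRankBall_zero {X : MatTuple F m η ℓ} {r : ℝ} :
    X ∈ sumRankBall 0 r ↔ (sumRankWeight X : ℝ) ≤ r := by
  simp [sumRankBall, sumRankDist, sumRankWeight_neg]

theorem smul_mem_sumRankBall_iff {c : F} (hc : c ≠ 0) {X : MatTuple F m η ℓ} {r : ℝ} :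
    c • X ∈ sumRankBall 0 r ↔ X ∈ sumRankBall 0 r := by
  rw [mem_sumRankBall_zero, mem_sumRankBall_zero, sumRankWeight_smul hc]

omit [Field F] in
theorem finite_matTuple [Finite F] : Finite (MatTuple F m η ℓ) :=
  have : Finite (Matrix (Fin m) (Fin η) F) := inferInstanceAs (Finite (Fin m → Fin η → F))
  inferInstance

variable [Finite F]

open Classical in
theorem card_matrix_rank_le_tangent (a : Matrix (Fin m) (Fin η) F) (hηm : η ≤ m)
    {ρ ε : ℝ} (hρ0 : 0 ≤ ρ) (hρ1 : ρ ≤ 1) (hε0 : 0 ≤ ε) (hε1 : ε ≤ 1) {r t : ℕ}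
    (hr : r ≤ η) (ht : t ≤ η) :
    (Nat.card {X : Matrix (Fin m) (Fin η) F // X.rank ≤ r ∧ (X + a).rank ≤ t} : ℝ) ≤
      (Nat.card F : ℝ) ^ (tangentExponent m η ρ r t + 3 * m + 1 -
        if ε * η ≤ a.rank then ε * ((1 - ρ) / 2) ^ 2 / 4 * (η : ℝ) ^ 2 else 0) := by
  have h := card_rank_le_tangent (Matrix.toLin' a) (by simpa using hηm) hρ0 hρ1 hε0 hε1
    (r := r) (t := t) (by simpa using hr) (by simpa using ht)
  simp only [Module.finrank_fin_fun] at h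
  have e : {X : Matrix (Fin m) (Fin η) F // X.rank ≤ r ∧ (X + a).rank ≤ t} ≃
      {X : (Fin η → F) →ₗ[F] (Fin m → F) // Module.finrank F (LinearMap.range X) ≤ r ∧
        Module.finrank F (LinearMap.range (X + Matrix.toLin' a)) ≤ t} := by
    refine Matrix.toLin'.toEquiv.subtypeEquiv fun X => ?_
    change _ ↔ Module.finrank F (LinearMap.range (Matrix.toLin' X)) ≤ r ∧
      Module.finrank F (LinearMap.range (Matrix.toLin' X + Matrix.toLin' a)) ≤ t
    rw [← map_add]
    rfl
  rw [Nat.card_congr e]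
  exact h

theorem rpow_le_card_matrix_rank_le (hηm : η ≤ m) {ρ : ℝ} (hρ0 : 0 ≤ ρ) (hρ1 : ρ ≤ 1) :
    (Nat.card F : ℝ) ^ ((m + η - ρ * η) * (ρ * η) - 3 * m : ℝ) ≤
      Nat.card {X : Matrix (Fin m) (Fin η) F // X.rank ≤ ⌊ρ * η⌋₊} := by
  have h := rpow_le_card_rank_le (F := F) (V := Fin η → F) (W := Fin m → F)
    (by simpa using hηm) hρ0 hρ1
  simp only [Module.finrank_fin_fun] at h
  have e : {X : Matrix (Fin m) (Fin η) F // X.rank ≤ ⌊ρ * η⌋₊} ≃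
      {X : (Fin η → F) →ₗ[F] (Fin m → F) //
        Module.finrank F (LinearMap.range X) ≤ ⌊ρ * η⌋₊} :=
    Matrix.toLin'.toEquiv.subtypeEquiv fun X => Iff.rfl
  rw [Nat.card_congr e]
  exact h

open Classical in
/-- The number of points of a ball whose translate by `a` is again in the ball. -/
theorem card_ball_inter_translate_le (a : MatTuple F m η ℓ) (hηm : η ≤ m)
    {ρ ε : ℝ} (hρ0 : 0 ≤ ρ) (hρ1 : ρ ≤ 1) (hε0 : 0 ≤ ε) (hε1 : ε ≤ 1) :
    (Nat.card {X : MatTuple F m η ℓ // X ∈ sumRankBall 0 (ρ * (η * ℓ)) ∧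
        X + a ∈ sumRankBall 0 (ρ * (η * ℓ))} : ℝ) ≤
      (Nat.card F : ℝ) ^ (ℓ * ((m + η - ρ * η) * (ρ * η) + 3 * m + 1) + 2 * η * ℓ -
        ε * ((1 - ρ) / 2) ^ 2 / 4 * (η : ℝ) ^ 2 *
          (Finset.univ.filter fun i => ε * η ≤ ((a i).rank : ℝ)).card) := by
  have hq := two_le_natCard_field F
  have hq0 : (0 : ℝ) < Nat.card F := by linarith
  have : Finite (Matrix (Fin m) (Fin η) F) := inferInstanceAs (Finite (Fin m → Fin η → F))
  have hηm' : (η : ℝ) ≤ m := by exact_mod_cast hηm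
  have hη0 : (0 : ℝ) ≤ η := by positivity
  let Pr := Fin ℓ → Fin (η + 1)
  let good : Pr × Pr → Prop := fun p =>
    ((∑ i, (p.1 i : ℕ) : ℕ) : ℝ) ≤ ρ * (η * ℓ) ∧ ((∑ i, (p.2 i : ℕ) : ℕ) : ℝ) ≤ ρ * (η * ℓ)
  let blk : Pr × Pr → Fin ℓ → Type _ := fun p i =>
    {Y : Matrix (Fin m) (Fin η) F // Y.rank ≤ p.1 i ∧ (Y + a i).rank ≤ p.2 i}
  have hrk : ∀ Y : Matrix (Fin m) (Fin η) F, Y.rank < η + 1 := fun Y =>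
    Nat.lt_succ_of_le (by simpa using Y.rank_le_width)
  -- Points are sorted by the rank profiles of X and X + a. There are at most (η + 1)^(2ℓ) ≤ q^(2ηℓ)
  -- pairs of profiles, and within one pair the count factors over the blocks.
  have h1 : Nat.card {X : MatTuple F m η ℓ // X ∈ sumRankBall 0 (ρ * (η * ℓ)) ∧
        X + a ∈ sumRankBall 0 (ρ * (η * ℓ))} ≤
      Nat.card (Σ p : {p // good p}, ∀ i, blk p.1 i) := by
    refine Nat.card_le_card_of_injective (fun X => ⟨⟨(fun i => ⟨(X.1 i).rank, hrk _⟩,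
      fun i => ⟨(X.1 i + a i).rank, hrk _⟩), mem_sumRankBall_zero.1 X.2.1,
      mem_sumRankBall_zero.1 X.2.2⟩, fun i => ⟨X.1 i, le_rfl, le_rfl⟩⟩) ?_
    intro X Y h
    have h2 := congrArg (fun s : (Σ p : {p // good p}, ∀ i, blk p.1 i) =>
      fun i => ((s.2 i).1 : Matrix (Fin m) (Fin η) F)) h
    exact Subtype.ext h2
  refine (Nat.cast_le.2 h1).trans ?_
  rw [Nat.card_sigma]
  push_cast [Nat.card_pi]
  set c := ε * ((1 - ρ) / 2) ^ 2 / 4 * (η : ℝ) ^ 2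
  set T := Finset.univ.filter fun i => ε * η ≤ ((a i).rank : ℝ)
  have h2 : ∀ p : {p // good p}, ∏ i, (Nat.card (blk p.1 i) : ℝ) ≤
      (Nat.card F : ℝ) ^ (ℓ * ((m + η - ρ * η) * (ρ * η) + 3 * m + 1) - c * T.card) := by
    rintro ⟨⟨r, t⟩, hr, ht⟩
    refine (Finset.prod_le_prod (fun i _ => by positivity) fun i _ =>
      card_matrix_rank_le_tangent (a i) hηm hρ0 hρ1 hε0 hε1
        (Nat.le_of_lt_succ (r i).2) (Nat.le_of_lt_succ (t i).2)).trans ?_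
    rw [← Real.rpow_sum_of_pos hq0]
    refine Real.rpow_le_rpow_of_exponent_le (by linarith) ?_
    push_cast at hr ht
    have hT : ∑ i, (if ε * η ≤ ((a i).rank : ℝ) then c else 0) = c * T.card := by
      rw [← Finset.sum_filter, Finset.sum_const, nsmul_eq_mul, mul_comm]
    -- The tangent plane is affine, so only the total ranks matter. Both slopes are nonnegative and
    -- both totals are at most ρηℓ, so the correction terms can be dropped.
    have htan : ∑ i, tangentExponent m η ρ (r i : ℕ) (t i : ℕ) =
        ℓ * ((m + η - ρ * η) * (ρ * η)) +
        (m - ρ * η) * (∑ i, ((r i : ℕ) : ℝ) - ρ * (η * ℓ)) +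
        (η - ρ * η) * (∑ i, ((t i : ℕ) : ℝ) - ρ * (η * ℓ)) := by
      simp only [tangentExponent, Finset.sum_add_distrib, ← Finset.mul_sum,
        Finset.sum_sub_distrib, Finset.sum_const, Finset.card_univ, Fintype.card_fin, nsmul_eq_mul]
      ring
    rw [Finset.sum_sub_distrib, hT, Finset.sum_add_distrib, Finset.sum_add_distrib, htan]
    simp only [Finset.sum_const, Finset.card_univ, Fintype.card_fin, nsmul_eq_mul]
    have hρη : ρ * η ≤ η := by nlinarith
    have e1 := mul_nonneg (sub_nonneg.2 (hρη.trans hηm')) (sub_nonneg.2 hr)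
    have e2 := mul_nonneg (sub_nonneg.2 hρη) (sub_nonneg.2 ht)
    linarith
  refine (Finset.sum_le_card_nsmul _ _ _ fun p _ => h2 p).trans ?_
  rw [nsmul_eq_mul, Finset.card_univ]
  have h3 : (Fintype.card {p // good p} : ℝ) ≤ (Nat.card F : ℝ) ^ (2 * η * ℓ : ℝ) := by
    have h4 : Fintype.card {p // good p} ≤ Fintype.card (Pr × Pr) := Fintype.card_subtype_le _
    have h5 : Fintype.card (Pr × Pr) = (η + 1) ^ ℓ * (η + 1) ^ ℓ := by simp [Pr]
    have h6 : (η + 1) ^ ℓ * (η + 1) ^ ℓ ≤ Nat.card F ^ (2 * η * ℓ) := by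
      have h7 : η + 1 ≤ Nat.card F ^ η :=
        (Nat.lt_two_pow_self (n := η)).trans_le
          (Nat.pow_le_pow_left (by exact_mod_cast hq) _)
      calc (η + 1) ^ ℓ * (η + 1) ^ ℓ ≤ (Nat.card F ^ η) ^ ℓ * (Nat.card F ^ η) ^ ℓ := by gcongr
        _ = _ := by rw [← pow_mul, ← pow_add]; congr 1; ring
    have h8 : (Nat.card F : ℝ) ^ (2 * η * ℓ : ℝ) = ((Nat.card F ^ (2 * η * ℓ) : ℕ) : ℝ) := by
      rw [Nat.cast_pow, ← Real.rpow_natCast]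
      push_cast
      rfl
    rw [h8]
    exact_mod_cast (h4.trans h5.le).trans h6
  refine (mul_le_mul_of_nonneg_right h3 (by positivity)).trans ?_
  rw [← Real.rpow_add hq0]
  refine Real.rpow_le_rpow_of_exponent_le (by linarith) ?_
  linarith

/-- Tuples with every block of rank at most ⌊ρη⌋ already lie in the ball and reach the exponent of
the upper bound up to O(mℓ). -/
theorem rpow_le_card_ball (hηm : η ≤ m) {ρ : ℝ} (hρ0 : 0 ≤ ρ) (hρ1 : ρ ≤ 1) :
    (Nat.card F : ℝ) ^ (ℓ * ((m + η - ρ * η) * (ρ * η) - 3 * m) : ℝ) ≤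
      Nat.card (sumRankBall (0 : MatTuple F m η ℓ) (ρ * (η * ℓ))) := by
  have hq := two_le_natCard_field F
  have hq0 : (0 : ℝ) < Nat.card F := by linarith
  have : Finite (MatTuple F m η ℓ) := finite_matTuple
  have h1 : Nat.card (Fin ℓ → {X : Matrix (Fin m) (Fin η) F // X.rank ≤ ⌊ρ * η⌋₊}) ≤
      Nat.card (sumRankBall (0 : MatTuple F m η ℓ) (ρ * (η * ℓ))) := by
    refine Nat.card_le_card_of_injective (fun X => ⟨fun i => (X i).1, ?_⟩) ?_
    · rw [mem_sumRankBall_zero, sumRankWeight]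
      push_cast
      calc ∑ i, (((X i).1.rank : ℕ) : ℝ) ≤ ∑ i : Fin ℓ, ρ * η := by
            refine Finset.sum_le_sum fun i _ => ?_
            exact (Nat.cast_le.2 (X i).2).trans (Nat.floor_le (by positivity))
        _ = _ := by simp; ring
    · intro X Y h
      funext i
      exact Subtype.ext (congrFun (congrArg Subtype.val h) i)
  refine le_trans ?_ (Nat.cast_le.2 h1)
  rw [Nat.card_fun, Nat.card_fin, mul_comm, Real.rpow_mul hq0.le, Real.rpow_natCast]
  push_cast
  exact pow_le_pow_left₀ (by positivity) (rpow_le_card_matrix_rank_le hηm hρ0 hρ1) _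

omit [Finite F] in
/-- A tuple of large weight has many blocks of large rank. -/
theorem le_card_large_blocks (a : MatTuple F m η ℓ) {ρ : ℝ} (hρ0 : 0 ≤ ρ) (hη : 0 < η)
    (ha : ρ / 2 * (η * ℓ) < sumRankWeight a) :
    ρ / 4 * ℓ ≤ (Finset.univ.filter fun i => ρ / 4 * η ≤ ((a i).rank : ℝ)).card := by
  set T := Finset.univ.filter fun i => ρ / 4 * η ≤ ((a i).rank : ℝ) with hT
  have hη' : (0 : ℝ) < η := by exact_mod_cast hη
  -- A block in T has rank at most η, any other less than ρη/4.
  have h1 : (sumRankWeight a : ℝ) ≤ T.card * η + ℓ * (ρ / 4 * η) := by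
    calc (sumRankWeight a : ℝ)
        ≤ ∑ i, ((if ρ / 4 * η ≤ ((a i).rank : ℝ) then (η : ℝ) else 0) + ρ / 4 * η) := by
          rw [sumRankWeight]
          push_cast
          refine Finset.sum_le_sum fun i _ => ?_
          have h2 : ((a i).rank : ℝ) ≤ η := by exact_mod_cast by simpa using (a i).rank_le_width
          have h3 : 0 ≤ ρ / 4 * η := by positivity
          split_ifs with h <;> linarith
      _ = _ := by
          rw [Finset.sum_add_distrib, ← Finset.sum_filter]
          simp [T]
  refine le_of_mul_le_mul_right ?_ hη'
  linarith

end

/-! ### The two-point estimate -/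

/-- A translated combination of two random points of the ball lies in the ball with probability
exponentially small in `m η ℓ`. -/
theorem exists_card_pair_le (F : Type*) [Field F] [Finite F] {ρ β : ℝ} (hρ0 : 0 < ρ)
    (hρ1 : ρ < 1) (hβ : 0 < β) :
    ∃ δ : ℝ, 0 < δ ∧ ∃ m₀ : ℕ, 1 ≤ m₀ ∧ ∀ m η ℓ : ℕ, m₀ ≤ m → β * m ≤ η → η ≤ m → 1 ≤ ℓ →
      ∀ α α' : F, α ≠ 0 → α' ≠ 0 → ∀ b : MatTuple F m η ℓ,
        (Nat.card {p : sumRankBall (0 : MatTuple F m η ℓ) (ρ * (η * ℓ)) ×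
            sumRankBall (0 : MatTuple F m η ℓ) (ρ * (η * ℓ)) //
            α • p.1.1 + α' • p.2.1 + b ∈ sumRankBall 0 (ρ * (η * ℓ))} : ℝ) ≤
          (Nat.card F : ℝ) ^ (-(δ * (m * (η * ℓ)))) *
            (Nat.card (sumRankBall (0 : MatTuple F m η ℓ) (ρ * (η * ℓ))) : ℝ) ^ 2 := by
  classical
  have hq := two_le_natCard_field F
  have hq0 : (0 : ℝ) < Nat.card F := by linarith
  -- A fraction ρ/4 of blocks is large, each saving ε((1 - ρ)/2)²/4 · η² with ε = ρ/4.
  set c := ρ / 4 * (ρ / 4 * ((1 - ρ) / 2) ^ 2 / 4) with hc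
  have hc0 : 0 < c := by
    have : 0 < (1 - ρ) / 2 := by linarith
    positivity
  have hcρ : c ≤ ρ / 4 := by
    have h1 : (1 - ρ) / 2 ≤ 1 := by linarith
    have h2 : 0 ≤ (1 - ρ) / 2 := by linarith
    have h3 : ((1 - ρ) / 2) ^ 2 ≤ 1 := pow_le_one₀ h2 h1
    have h4 : ρ / 4 * ((1 - ρ) / 2) ^ 2 / 4 ≤ 1 := by nlinarith
    rw [hc]
    nlinarith
  -- The saving cη²ℓ is at least cβmηℓ, while the errors total at most 10mℓ. For m ≥ 20/(cβ²) one
  -- has cβη ≥ 20, so the errors use at most half of the saving.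
  refine ⟨c * β / 2, by positivity, ⌈20 / (c * β ^ 2)⌉₊ + 1, by omega, ?_⟩
  intro m η ℓ hm hβη hηm hℓ α α' hα hα' b
  have hmR : 20 / (c * β ^ 2) ≤ m := by
    refine (Nat.le_ceil _).trans ?_
    exact_mod_cast (by omega)
  have hm1 : (1 : ℝ) ≤ m := by exact_mod_cast (by omega)
  have hℓ1 : (1 : ℝ) ≤ ℓ := by exact_mod_cast hℓ
  have hηm' : (η : ℝ) ≤ m := by exact_mod_cast hηm
  have hη0 : (0 : ℝ) < η := lt_of_lt_of_le (by positivity) hβη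
  have hη20 : 20 ≤ c * β * η := by
    rw [div_le_iff₀ (by positivity)] at hmR
    calc 20 ≤ m * (c * β ^ 2) := hmR
      _ = c * β * (β * m) := by ring
      _ ≤ _ := by gcongr
  have hη1 : 0 < η := by exact_mod_cast hη0
  have : Finite (MatTuple F m η ℓ) := finite_matTuple
  let M := MatTuple F m η ℓ
  set B := sumRankBall (0 : MatTuple F m η ℓ) (ρ * (η * ℓ)) with hB
  set Nb := (Nat.card B : ℝ) with hNb
  have hNb0 : 0 ≤ Nb := by positivity
  set x := -(c * η ^ 2 * ℓ) + ℓ * (6 * m + 1) + 2 * η * ℓ with hx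
  have hlow := rpow_le_card_ball (F := F) (ℓ := ℓ) hηm hρ0.le hρ1.le
  rw [← hB, ← hNb] at hlow
  have hmain : ∀ y, y ≤ (ℓ * ((m + η - ρ * η) * (ρ * η) - 3 * m) : ℝ) + x →
      (Nat.card F : ℝ) ^ y ≤ Nb * (Nat.card F : ℝ) ^ x := by
    intro y hy
    refine (Real.rpow_le_rpow_of_exponent_le (by linarith) hy).trans ?_
    rw [Real.rpow_add hq0]
    exact mul_le_mul_of_nonneg_right hlow (by positivity)
  -- Translation by 0 with ε = 0 bounds the ball of radius ρn/2 itself; halving ρ lowers the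
  -- exponent by at least ρη²/4 ≥ cη² per block.
  have hsmall : (Nat.card (sumRankBall (0 : MatTuple F m η ℓ) (ρ / 2 * (η * ℓ))) : ℝ) ≤
      Nb * (Nat.card F : ℝ) ^ x := by
    have h := card_ball_inter_translate_le (0 : MatTuple F m η ℓ) hηm (ρ := ρ / 2) (ε := 0)
      (by linarith) (by linarith) le_rfl zero_le_one
    simp only [add_zero, and_self, zero_mul, zero_div, sub_zero] at h
    refine h.trans (hmain _ ?_)
    have h1 : c * η ^ 2 * ℓ ≤ ρ / 4 * η ^ 2 * ℓ := by gcongr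
    have h2 : ρ / 4 * η ^ 2 ≤ (m + η - ρ * η) * (ρ * η) - (m + η - ρ / 2 * η) * (ρ / 2 * η) := by
      have h3 : η * (ρ * η) ≤ m * (ρ * η) := by gcongr
      have h4 : ρ * (ρ * η ^ 2) ≤ 1 * (ρ * η ^ 2) := by gcongr
      nlinarith
    have h5 := mul_le_mul_of_nonneg_right h2 (by positivity : (0 : ℝ) ≤ ℓ)
    rw [hx]
    linarith
  have hlarge : ∀ a : M, ρ / 2 * (η * ℓ) < sumRankWeight a →
      (Nat.card {X : M // X ∈ B ∧ X + a ∈ B} : ℝ) ≤ Nb * (Nat.card F : ℝ) ^ x := by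
    intro a ha
    have h := card_ball_inter_translate_le a hηm (ρ := ρ) (ε := ρ / 4)
      hρ0.le hρ1.le (by linarith) (by linarith)
    refine h.trans (hmain _ ?_)
    have h1 := le_card_large_blocks a hρ0.le hη1 ha
    have h2 : 0 ≤ ρ / 4 * ((1 - ρ) / 2) ^ 2 / 4 * (η : ℝ) ^ 2 := by positivity
    have h3 := mul_le_mul_of_nonneg_left h1 h2
    have h4 : ρ / 4 * ((1 - ρ) / 2) ^ 2 / 4 * (η : ℝ) ^ 2 * (ρ / 4 * ℓ) = c * η ^ 2 * ℓ := by
      rw [hc]; ring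
    rw [h4] at h3
    rw [hx]
    linarith
  let a : B → M := fun X => α'⁻¹ • (α • X.1 + b)
  have hiff : ∀ X Y : B, α • X.1 + α' • Y.1 + b ∈ B ↔ Y.1 + a X ∈ B := by
    intro X Y
    refine Iff.trans ?_ (smul_mem_sumRankBall_iff hα' (X := Y.1 + a X))
    have : α' • (Y.1 + a X) = α • X.1 + α' • Y.1 + b := by
      simp only [a, smul_add, smul_inv_smul₀ hα']
      abel
    rw [this]
  have hfin : Fintype B := Fintype.ofFinite _
  have hrow : ∀ X : B, (Nat.card {Y : B // α • X.1 + α' • Y.1 + b ∈ B} : ℝ) ≤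
      (if a X ∈ sumRankBall (0 : M) (ρ / 2 * (η * ℓ)) then Nb else 0) +
        Nb * (Nat.card F : ℝ) ^ x := by
    intro X
    split_ifs with h
    · have h1 : (Nat.card {Y : B // α • X.1 + α' • Y.1 + b ∈ B} : ℝ) ≤ Nb := by
        rw [hNb]
        exact Nat.cast_le.2 (Nat.card_le_card_of_injective _ Subtype.val_injective)
      have : 0 ≤ Nb * (Nat.card F : ℝ) ^ x := by positivity
      linarith
    · rw [zero_add]
      rw [mem_sumRankBall_zero, not_le] at h
      refine le_trans ?_ (hlarge _ h)
      refine Nat.cast_le.2 (Nat.card_le_card_of_injective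
        (fun Y => ⟨Y.1.1, Y.1.2, (hiff X Y.1).1 Y.2⟩) ?_)
      intro Y Y' h
      exact Subtype.ext (Subtype.ext (congrArg (fun Z => Z.1) h))
  rw [card_subtype_prod (fun X Y : B => α • X.1 + α' • Y.1 + b ∈ B)]
  push_cast
  refine (Finset.sum_le_sum fun X _ => hrow X).trans ?_
  rw [Finset.sum_add_distrib, ← Finset.sum_filter, Finset.sum_const, Finset.sum_const,
    Finset.card_univ, ← Nat.card_eq_fintype_card, nsmul_eq_mul, nsmul_eq_mul]
  -- As α ≠ 0, the map X ↦ a X is injective, so few X have a translation in the small ball.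
  have hcnt : ((Finset.univ.filter fun X : B =>
      a X ∈ sumRankBall (0 : M) (ρ / 2 * (η * ℓ))).card : ℝ) ≤ Nb * (Nat.card F : ℝ) ^ x := by
    refine le_trans ?_ hsmall
    rw [← Nat.subtype_card (p := fun X : B => a X ∈ sumRankBall (0 : M) (ρ / 2 * (η * ℓ))) _
      (by simp)]
    refine Nat.cast_le.2 (Nat.card_le_card_of_injective (fun X => ⟨a X.1, X.2⟩) ?_)
    intro X X' h
    have h1 : a X.1 = a X'.1 := congrArg Subtype.val h
    simp only [a] at h1
    have h2 := smul_right_injective M (inv_ne_zero hα') h1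
    have h3 := smul_right_injective M hα (add_right_cancel h2)
    exact Subtype.ext (Subtype.ext h3)
  have hfinal : 2 * (Nat.card F : ℝ) ^ x ≤
      (Nat.card F : ℝ) ^ (-(c * β / 2 * (m * (η * ℓ)))) := by
    calc 2 * (Nat.card F : ℝ) ^ x ≤ (Nat.card F : ℝ) ^ (1 : ℝ) * (Nat.card F : ℝ) ^ x := by
          rw [Real.rpow_one]
          gcongr
      _ = (Nat.card F : ℝ) ^ (1 + x) := (Real.rpow_add hq0 _ _).symm
      _ ≤ _ := by
          refine Real.rpow_le_rpow_of_exponent_le (by linarith) ?_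
          have h1 : (1 : ℝ) ≤ m * ℓ := one_le_mul_of_one_le_of_one_le hm1 hℓ1
          have h2 : (η : ℝ) * ℓ ≤ m * ℓ := by gcongr
          have h3 : (1 : ℝ) * ℓ ≤ m * ℓ := by gcongr
          have h4 : 20 * (m * ℓ) ≤ c * β * η * (m * ℓ) := by gcongr
          have h5 : c * η * ℓ * (β * m) ≤ c * η * ℓ * η := by gcongr
          rw [hx]
          nlinarith
  calc _ ≤ Nb * (Nat.card F : ℝ) ^ x * Nb + Nb * (Nb * (Nat.card F : ℝ) ^ x) := by
        gcongr
    _ = 2 * (Nat.card F : ℝ) ^ x * Nb ^ 2 := by ring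
    _ ≤ _ := by gcongr

/-! ### Chains in large sets of coefficient vectors -/

/-- The family `v - w` is a chain in which each vector has two nonzero coordinates that are zero
in all later vectors. -/
def IsTwoChain {F : Type*} {γ d : ℕ} (v : Fin d → Fin γ → F) (w : Fin γ → F) : Prop :=
  ∀ j, ∃ i k, i ≠ k ∧ v j i ≠ w i ∧ v j k ≠ w k ∧ ∀ j', j < j' → v j' i = w i ∧ v j' k = w k

section Chains

variable {F : Type*} [Fintype F] [DecidableEq F] {γ : ℕ}

theorem exists_popular_value [Nonempty F] {A : Type*} (S : Finset A) (f : A → F) :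
    ∃ c, S.card ≤ Fintype.card F * (S.filter fun x => f x = c).card := by
  obtain ⟨c, -, hc⟩ := Finset.exists_max_image Finset.univ
    (fun c => (S.filter fun x => f x = c).card) Finset.univ_nonempty
  refine ⟨c, ?_⟩
  rw [Finset.card_eq_sum_card_fiberwise (f := f) (t := Finset.univ) (fun _ _ => by simp)]
  simpa using Finset.sum_le_card_nsmul _ _ _ hc

/-- In a family of more than `q γ` vectors there are two coordinates, a popular pair of values on
them, and a member differing from that pair in both. -/
theorem exists_popular_pair [Nonempty F] (hγ : 1 ≤ γ) (S : Finset (Fin γ → F))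
    (hS : Fintype.card F * γ < S.card) :
    ∃ v ∈ S, ∃ i k, i ≠ k ∧ ∃ α β, v i ≠ α ∧ v k ≠ β ∧
      S.card ≤ Fintype.card F ^ 2 * (S.filter fun x => x i = α ∧ x k = β).card := by
  choose α hα using fun i => exists_popular_value S fun x : Fin γ → F => x i
  obtain ⟨v, hv, i, k, hik, hi, hk⟩ : ∃ v ∈ S, ∃ i k, i ≠ k ∧ v i ≠ α i ∧ v k ≠ α k := by
    by_contra! hcon
    -- Otherwise every member of S differs from the popular vector α in at most one coordinate,
    -- which leaves at most qγ vectors.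
    have hsub : S ⊆ (Finset.univ : Finset (Fin γ × F)).image
        fun p => Function.update α p.1 p.2 := by
      intro x hx
      rw [Finset.mem_image]
      by_cases h : ∃ i, x i ≠ α i
      · obtain ⟨i, hi⟩ := h
        refine ⟨(i, x i), Finset.mem_univ _, funext fun k => ?_⟩
        by_cases hki : k = i
        · subst hki
          simp
        · simpa [hki] using (hcon x hx i k (Ne.symm hki) hi).symm
      · push Not at h
        refine ⟨(⟨0, hγ⟩, x ⟨0, hγ⟩), Finset.mem_univ _, ?_⟩
        rw [funext h]
        simp
    have := (Finset.card_le_card hsub).trans Finset.card_image_le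
    simp only [Finset.card_univ, Fintype.card_prod, Fintype.card_fin] at this
    rw [mul_comm] at this
    omega
  have hpos : 0 < S.card := by omega
  obtain ⟨β, hβ⟩ := exists_popular_value (S.filter fun x => x i = α i) fun x => x k
  obtain ⟨α', hα'⟩ := exists_popular_value (S.filter fun x => x k = α k) fun x => x i
  rw [Finset.filter_filter] at hβ hα'
  have h1 : S.card ≤ Fintype.card F ^ 2 * (S.filter fun x => x i = α i ∧ x k = β).card := by
    calc S.card ≤ _ := hα i
      _ ≤ _ := Nat.mul_le_mul_left _ hβ
      _ = _ := by ring
  have h2 : S.card ≤ Fintype.card F ^ 2 * (S.filter fun x => x k = α k ∧ x i = α').card := by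
    calc S.card ≤ _ := hα k
      _ ≤ _ := Nat.mul_le_mul_left _ hα'
      _ = _ := by ring
  -- The conditional popular value β may differ from α k, and then v may fail. If both orders of
  -- conditioning go wrong, a member with x k = α k and x i = α' differs from (α i, β) in both
  -- places.
  by_cases hb : β = α k
  · exact ⟨v, hv, i, k, hik, α i, β, hi, hb ▸ hk, h1⟩
  by_cases ha : α' = α i
  · refine ⟨v, hv, k, i, hik.symm, α k, α', hk, ha ▸ hi, h2⟩
  · obtain ⟨x, hx⟩ : (S.filter fun x => x k = α k ∧ x i = α').Nonempty := by
      rw [← Finset.card_pos]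
      exact Nat.pos_of_mul_pos_left (hpos.trans_le h2)
    rw [Finset.mem_filter] at hx
    exact ⟨x, hx.1, i, k, hik, α i, β, hx.2.2 ▸ ha, hx.2.1 ▸ Ne.symm hb, h1⟩

/-- Each link passes to the class of a popular pair, shrinking the set by a factor of at most q².
All later vectors, and w, agree with that pair on its two coordinates, whereas the vector chosen
first differs there. -/
theorem exists_isTwoChain [Nontrivial F] (hγ : 1 ≤ γ) (d : ℕ) (S : Finset (Fin γ → F))
    (hS : Fintype.card F ^ (2 * d) * γ ≤ S.card) :
    ∃ (v : Fin d → Fin γ → F) (w : Fin γ → F), w ∈ S ∧ (∀ j, v j ∈ S) ∧ IsTwoChain v w := by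
  have hq : 2 ≤ Fintype.card F := Fintype.one_lt_card
  induction d generalizing S with
  | zero =>
    obtain ⟨w, hw⟩ : S.Nonempty := by
      rw [← Finset.card_pos]
      simp only [mul_zero, pow_zero, one_mul] at hS
      omega
    exact ⟨Fin.elim0, w, hw, fun j => j.elim0, fun j => j.elim0⟩
  | succ d ih =>
    have hd : 1 ≤ Fintype.card F ^ (2 * d) := Nat.one_le_pow _ _ (by omega)
    obtain ⟨x, hx, i, k, hik, α, β, hxi, hxk, hcard⟩ := exists_popular_pair hγ S (by
      refine lt_of_lt_of_le ?_ hS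
      have h1 : Fintype.card F < Fintype.card F ^ (2 * (d + 1)) := by
        rw [show 2 * (d + 1) = 2 * d + 2 by ring, pow_add]
        nlinarith
      exact Nat.mul_lt_mul_of_pos_right h1 hγ)
    obtain ⟨v, w, hw, hv, hch⟩ := ih (S.filter fun x => x i = α ∧ x k = β) (by
      refine Nat.le_of_mul_le_mul_left ?_ (by positivity : 0 < Fintype.card F ^ 2)
      refine le_trans (le_of_eq ?_) (hS.trans hcard)
      ring)
    rw [Finset.mem_filter] at hw
    have hv' := fun j => Finset.mem_filter.1 (hv j)
    refine ⟨Fin.cons x v, w, hw.1, Fin.cases hx fun j => (hv' j).1, ?_⟩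
    intro j
    refine Fin.cases ?_ (fun j => ?_) j
    · refine ⟨i, k, hik, by simpa [hw.2.1] using hxi, by simpa [hw.2.2] using hxk, ?_⟩
      intro j'
      refine Fin.cases (by simp) (fun j' _ => ?_) j'
      simp [hw.2.1, hw.2.2, (hv' j').2.1, (hv' j').2.2]
    · obtain ⟨i', k', h1, h2, h3, h4⟩ := hch j
      refine ⟨i', k', h1, by simpa using h2, by simpa using h3, ?_⟩
      intro j'
      refine Fin.cases (by simp) (fun j' hj' => ?_) j'
      simpa using h4 j' (by simpa using hj')

end Chains

/-! ### Resampling along a chain and the union bound -/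

section Peeling

variable {F M : Type*} [Field F] [AddCommGroup M] [Module F M] [Finite M] {γ : ℕ}

/-- Resampling two coordinates with nonzero coefficients, on which `P` does not depend. -/
theorem card_and_combination_mem_le {B : Set M} {p : ℝ}
    (hp : ∀ α α' : F, α ≠ 0 → α' ≠ 0 → ∀ b : M,
      (Nat.card {x : B × B // α • x.1.1 + α' • x.2.1 + b ∈ B} : ℝ) ≤ p * (Nat.card B : ℝ) ^ 2)
    {u : Fin γ → F} {i k : Fin γ} (hik : i ≠ k) (hi : u i ≠ 0) (hk : u k ≠ 0) (y : M)
    (P : (Fin γ → B) → Prop)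
    (hP : ∀ X X' : Fin γ → B, (∀ t, t ≠ i → t ≠ k → X t = X' t) → P X → P X') :
    (Nat.card {X : Fin γ → B // P X ∧ ∑ t, u t • (X t).1 + y ∈ B} : ℝ) ≤
      p * Nat.card {X : Fin γ → B // P X} := by
  classical
  have := Fintype.ofFinite M
  let Z := {t : Fin γ // t ≠ i ∧ t ≠ k} → B
  let g : (Fin γ → B) → Z := fun X t => X t.1
  have hsplit : ∀ Q : (Fin γ → B) → Prop, (Nat.card {X // Q X} : ℝ) =
      ∑ z : Z, (Nat.card {X // Q X ∧ g X = z} : ℝ) := by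
    intro Q
    rw [Nat.card_congr (Equiv.sigmaFiberEquiv fun X : {X // Q X} => g X.1).symm, Nat.card_sigma]
    push_cast
    refine Finset.sum_congr rfl fun z _ => ?_
    rw [Nat.card_congr (Equiv.subtypeSubtypeEquivSubtypeInter Q fun X => g X = z)]
  -- All coordinates except i and k are frozen. As P ignores these two, a fibre meeting P is a full
  -- copy of B × B, and `hp` applies to it with the frozen sum as part of the shift.
  rw [hsplit, hsplit, Finset.mul_sum]
  refine Finset.sum_le_sum fun z _ => ?_
  rcases isEmpty_or_nonempty {X : Fin γ → B // P X ∧ g X = z} with hE | ⟨X₀, hX₀, hz⟩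
  · have : IsEmpty {X : Fin γ → B // (P X ∧ ∑ t, u t • (X t).1 + y ∈ B) ∧ g X = z} :=
      ⟨fun X => hE.1 ⟨X.1, X.2.1.1, X.2.2⟩⟩
    simp
  have hagree : ∀ X : Fin γ → B, g X = z → ∀ t, t ≠ i → t ≠ k → X t = X₀ t := by
    intro X hX t h1 h2
    exact congrFun (hX.trans hz.symm) ⟨t, h1, h2⟩
  have hup : (Nat.card {X : Fin γ → B // (P X ∧ ∑ t, u t • (X t).1 + y ∈ B) ∧ g X = z} : ℝ) ≤
      p * (Nat.card B : ℝ) ^ 2 := by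
    let R := (Finset.univ.erase i).erase k
    refine le_trans (Nat.cast_le.2 ?_) (hp (u i) (u k) hi hk (∑ t ∈ R, u t • (X₀ t).1 + y))
    refine Nat.card_le_card_of_injective (fun X => ⟨(X.1 i, X.1 k), ?_⟩) ?_
    · have h1 := X.2.1.2
      rw [← Finset.add_sum_erase _ _ (Finset.mem_univ i),
        ← Finset.add_sum_erase _ _ (Finset.mem_erase.2 ⟨hik.symm, Finset.mem_univ k⟩)] at h1
      have h2 : ∑ t ∈ R, u t • (X.1 t).1 = ∑ t ∈ R, u t • (X₀ t).1 := by
        refine Finset.sum_congr rfl fun t ht => ?_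
        simp only [R, Finset.mem_erase] at ht
        rw [hagree X.1 X.2.2 t ht.2.1 ht.1]
      simpa only [R, h2, add_assoc] using h1
    · intro X X' h
      simp only [Subtype.mk.injEq, Prod.mk.injEq] at h
      refine Subtype.ext (funext fun t => ?_)
      by_cases hti : t = i
      · rw [hti, h.1]
      by_cases htk : t = k
      · rw [htk, h.2]
      rw [hagree X.1 X.2.2 t hti htk, hagree X'.1 X'.2.2 t hti htk]
  have hp0 : 0 ≤ p := by
    have h1 := (Nat.cast_nonneg _).trans (hp 1 1 one_ne_zero one_ne_zero 0)
    have h2 : (0 : ℝ) < (Nat.card B : ℝ) ^ 2 := by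
      have : Nonempty B := ⟨X₀ i⟩
      have : 0 < Nat.card B := Nat.card_pos
      positivity
    exact nonneg_of_mul_nonneg_left h1 h2
  refine hup.trans (mul_le_mul_of_nonneg_left ?_ hp0)
  rw [sq, ← Nat.cast_mul, ← Nat.card_prod]
  refine Nat.cast_le.2 (Nat.card_le_card_of_injective
    (fun x => ⟨Function.update (Function.update X₀ i x.1) k x.2, hP X₀ _ ?_ hX₀, ?_⟩) ?_)
  · intro t h1 h2
    simp [h1, h2]
  · rw [← hz]
    funext t
    simp [g, t.2.1, t.2.2]
  · rintro ⟨x, x'⟩ ⟨x₁, x₁'⟩ h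
    have h1 := congrArg Subtype.val h
    have h2 := congrFun h1 i
    have h3 := congrFun h1 k
    simp only [Function.update_self, ne_eq, hik, not_false_eq_true, Function.update_of_ne] at h2 h3
    rw [h2, h3]

/-- The two special coordinates of the first vector have coefficient zero in every later condition,
so resampling them gains a factor p without disturbing the rest. -/
theorem card_chain_combinations_mem_le {B : Set M} {p : ℝ} (hp0 : 0 ≤ p)
    (hp : ∀ α α' : F, α ≠ 0 → α' ≠ 0 → ∀ b : M,
      (Nat.card {x : B × B // α • x.1.1 + α' • x.2.1 + b ∈ B} : ℝ) ≤ p * (Nat.card B : ℝ) ^ 2)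
    {d : ℕ} (v : Fin d → Fin γ → F) (w : Fin γ → F) (h : IsTwoChain v w) (y : M) :
    (Nat.card {X : Fin γ → B // ∀ j, ∑ t, (v j t - w t) • (X t).1 + y ∈ B} : ℝ) ≤
      p ^ d * (Nat.card B : ℝ) ^ γ := by
  induction d with
  | zero =>
    rw [pow_zero, one_mul]
    have := Nat.card_le_card_of_injective _ (Subtype.val_injective
      (p := fun X : Fin γ → B => ∀ j : Fin 0, ∑ t, (v j t - w t) • (X t).1 + y ∈ B))
    rw [Nat.card_fun, Nat.card_fin] at this
    exact_mod_cast this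
  | succ d ih =>
    obtain ⟨i, k, hik, hi, hk, hlater⟩ := h 0
    have htail : IsTwoChain (fun j : Fin d => v j.succ) w := by
      intro j
      obtain ⟨i', k', h1, h2, h3, h4⟩ := h j.succ
      exact ⟨i', k', h1, h2, h3, fun j' hj' => h4 j'.succ (by simpa using hj')⟩
    have h1 := card_and_combination_mem_le hp (u := fun t => v 0 t - w t) hik
      (sub_ne_zero.2 hi) (sub_ne_zero.2 hk) y
      (fun X => ∀ j : Fin d, ∑ t, (v j.succ t - w t) • (X t).1 + y ∈ B) (by
        intro X X' hXX' hX j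
        have : ∑ t, (v j.succ t - w t) • (X' t).1 = ∑ t, (v j.succ t - w t) • (X t).1 := by
          refine Finset.sum_congr rfl fun t _ => ?_
          have hl := hlater j.succ (Fin.succ_pos j)
          by_cases hti : t = i
          · rw [hti, hl.1, sub_self, zero_smul, zero_smul]
          by_cases htk : t = k
          · rw [htk, hl.2, sub_self, zero_smul, zero_smul]
          rw [hXX' t hti htk]
        rw [this]
        exact hX j)
    have h2 := mul_le_mul_of_nonneg_left (ih (fun j => v j.succ) htail) hp0
    have e : {X : Fin γ → B // ∀ j, ∑ t, (v j t - w t) • (X t).1 + y ∈ B} ≃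
        {X : Fin γ → B // (∀ j : Fin d, ∑ t, (v j.succ t - w t) • (X t).1 + y ∈ B) ∧
          ∑ t, (v 0 t - w t) • (X t).1 + y ∈ B} :=
      Equiv.subtypeEquivRight fun X => by rw [Fin.forall_fin_succ, and_comm]
    rw [Nat.card_congr e]
    refine h1.trans (h2.trans (le_of_eq ?_))
    ring

/-- Union bound over the chains contained in a large set of coefficient vectors. -/
theorem card_large_span_inter_le [Fintype F] {B : Set M} {p : ℝ} (hp0 : 0 ≤ p)
    (hp : ∀ α α' : F, α ≠ 0 → α' ≠ 0 → ∀ b : M,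
      (Nat.card {x : B × B // α • x.1.1 + α' • x.2.1 + b ∈ B} : ℝ) ≤ p * (Nat.card B : ℝ) ^ 2)
    (hγ : 1 ≤ γ) (d : ℕ) :
    (Nat.card {X : Fin γ → B // Fintype.card F ^ (2 * d) * γ ≤
        ((Submodule.span F (Set.range fun t => (X t).1) : Set M) ∩ B).ncard} : ℝ) ≤
      (Fintype.card F : ℝ) ^ (γ * (d + 1)) * Nat.card M * (p ^ d * (Nat.card B : ℝ) ^ γ) := by
  classical
  have := Fintype.ofFinite M
  let I := {c : (Fin d → Fin γ → F) × (Fin γ → F) // IsTwoChain c.1 c.2} × M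
  -- The shift Σ w_t X_t depends on X. Letting it range over all of M as a free y restores
  -- independence at the cost of a factor |M|.
  have key : ∀ X : {X : Fin γ → B // Fintype.card F ^ (2 * d) * γ ≤
      ((Submodule.span F (Set.range fun t => (X t).1) : Set M) ∩ B).ncard},
      ∃ c : I, ∀ j, ∑ t, (c.1.1.1 j t - c.1.1.2 t) • (X.1 t).1 + c.2 ∈ B := by
    rintro ⟨X, hX⟩
    let S := Finset.univ.filter fun c : Fin γ → F => ∑ t, c t • (X t).1 ∈ B
    have hS : ((Submodule.span F (Set.range fun t => (X t).1) : Set M) ∩ B).ncard ≤ S.card := by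
      have hsub : (Submodule.span F (Set.range fun t => (X t).1) : Set M) ∩ B ⊆
          ((S.image fun c => ∑ t, c t • (X t).1 : Finset M) : Set M) := by
        rintro x ⟨hx, hxB⟩
        obtain ⟨c, rfl⟩ := (Submodule.mem_span_range_iff_exists_fun F).1 hx
        simp only [Finset.coe_image, Set.mem_image]
        exact ⟨c, by simpa [S] using hxB, rfl⟩
      refine (Set.ncard_le_ncard hsub (Finset.finite_toSet _)).trans ?_
      rw [Set.ncard_coe_finset]
      exact Finset.card_image_le
    obtain ⟨v, w, -, hv, hch⟩ := exists_isTwoChain hγ d S (hX.trans hS)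
    refine ⟨(⟨(v, w), hch⟩, ∑ t, w t • (X t).1), fun j => ?_⟩
    have := (Finset.mem_filter.1 (hv j)).2
    simpa only [sub_smul, Finset.sum_sub_distrib, sub_add_cancel] using this
  choose c hc using key
  have h1 := Nat.card_le_card_of_injective (β := Σ c : I, {X : Fin γ → B //
      ∀ j, ∑ t, (c.1.1.1 j t - c.1.1.2 t) • (X t).1 + c.2 ∈ B})
    (fun X => ⟨c X, X.1, hc X⟩) (by
      intro X X' h
      have := congrArg (fun s : (Σ c : I, {X : Fin γ → B //
        ∀ j, ∑ t, (c.1.1.1 j t - c.1.1.2 t) • (X t).1 + c.2 ∈ B}) => s.2.1) h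
      exact Subtype.ext this)
  refine (Nat.cast_le.2 h1).trans ?_
  rw [Nat.card_sigma]
  push_cast
  refine (Finset.sum_le_card_nsmul _ _ _ fun c _ =>
    card_chain_combinations_mem_le hp0 hp c.1.1.1 c.1.1.2 c.1.2 c.2).trans ?_
  rw [nsmul_eq_mul]
  refine mul_le_mul_of_nonneg_right ?_ (by positivity)
  rw [Finset.card_univ, Fintype.card_prod, ← Nat.card_eq_fintype_card (α := M), Nat.cast_mul]
  refine mul_le_mul_of_nonneg_right ?_ (by positivity)
  refine (Nat.cast_le.2 (Fintype.card_subtype_le _)).trans (le_of_eq ?_)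
  simp only [Fintype.card_prod, Fintype.card_fun, Fintype.card_fin]
  push_cast
  ring

end Peeling

/-! ### Probabilities as normalised counts -/

section

variable {F : Type*} [Field F] [Finite F] {m η ℓ : ℕ}

omit [Finite F] in
theorem zero_mem_sumRankBall {r : ℝ} (hr : 0 ≤ r) : (0 : MatTuple F m η ℓ) ∈ sumRankBall 0 r := by
  rw [mem_sumRankBall_zero]
  simpa [sumRankWeight] using hr

omit [Field F] in
theorem uniformOn_ball_real_singleton [MeasurableSpace (MatTuple F m η ℓ)]
    [MeasurableSingletonClass (MatTuple F m η ℓ)] (B : Set (MatTuple F m η ℓ))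
    (x : MatTuple F m η ℓ) [Decidable (x ∈ B)] :
    (uniformOn B).real {x} = if x ∈ B then (Nat.card B : ℝ)⁻¹ else 0 := by
  classical
  have : Finite (MatTuple F m η ℓ) := finite_matTuple
  have := Fintype.ofFinite (MatTuple F m η ℓ)
  have h := uniformOn_apply_finset (s := B.toFinset) (t := {x})
  rw [Set.coe_toFinset, Finset.coe_singleton] at h
  rw [Measure.real, h, ENNReal.toReal_div, ENNReal.toReal_natCast, ENNReal.toReal_natCast,
    Set.toFinset_card, ← Nat.card_eq_fintype_card]
  split_ifs with hx
  · rw [Finset.inter_singleton_of_mem (Set.mem_toFinset.2 hx)]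
    simp
  · rw [Finset.inter_singleton_of_notMem (by simpa using hx)]
    simp

theorem iidBallProb_eq {r : ℝ} (hr : 0 ≤ r) (γ : ℕ) (E : Set (Fin γ → MatTuple F m η ℓ)) :
    iidBallProb r γ E =
      (Nat.card {X : Fin γ → sumRankBall (0 : MatTuple F m η ℓ) r //
        (fun t => (X t).1) ∈ E} : ℝ) /
      (Nat.card (sumRankBall (0 : MatTuple F m η ℓ) r) : ℝ) ^ γ := by
  classical
  have : Finite (MatTuple F m η ℓ) := finite_matTuple
  let _ : MeasurableSpace (MatTuple F m η ℓ) := ⊤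
  have : MeasurableSingletonClass (MatTuple F m η ℓ) := ⟨fun _ => trivial⟩
  set B := sumRankBall (0 : MatTuple F m η ℓ) r with hB
  have hprob : IsProbabilityMeasure (uniformOn B) :=
    isProbabilityMeasure_uniformOn B.toFinite ⟨0, zero_mem_sumRankBall hr⟩
  change (Measure.pi fun _ : Fin γ => uniformOn B).real E = _
  have h1 := sum_measureReal_singleton (μ := Measure.pi fun _ : Fin γ => uniformOn B)
    E.toFinite.toFinset
  rw [Set.Finite.coe_toFinset] at h1
  rw [← h1]
  have h2 : ∀ X : Fin γ → MatTuple F m η ℓ,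
      (Measure.pi fun _ : Fin γ => uniformOn B).real {X} =
        if ∀ t, X t ∈ B then ((Nat.card B : ℝ) ^ γ)⁻¹ else 0 := by
    intro X
    rw [Measure.real, Measure.pi_singleton, ENNReal.toReal_prod]
    change ∏ t, (uniformOn B).real {X t} = _
    simp only [uniformOn_ball_real_singleton]
    split_ifs with h
    · simp [h]
    · push Not at h
      obtain ⟨t, ht⟩ := h
      exact Finset.prod_eq_zero (Finset.mem_univ t) (by simp [ht])
  simp only [h2]
  rw [← Finset.sum_filter, Finset.sum_const, nsmul_eq_mul, div_eq_mul_inv]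
  congr 2
  rw [← Nat.subtype_card (p := fun X : Fin γ → MatTuple F m η ℓ => X ∈ E ∧ ∀ t, X t ∈ B) _
    (by simp)]
  refine Nat.card_congr ⟨fun X => ⟨fun t => ⟨X.1 t, X.2.2 t⟩, X.2.1⟩,
    fun X => ⟨fun t => (X.1 t).1, X.2, fun t => (X.1 t).2⟩, fun _ => rfl, fun _ => rfl⟩

theorem iidBallProb_le_one {r : ℝ} (hr : 0 ≤ r) (γ : ℕ) (E : Set (Fin γ → MatTuple F m η ℓ)) :
    iidBallProb r γ E ≤ 1 := by
  have : Finite (MatTuple F m η ℓ) := finite_matTuple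
  rw [iidBallProb_eq hr]
  refine div_le_one_of_le₀ ?_ (by positivity)
  have := Nat.card_le_card_of_injective _ (Subtype.val_injective
    (p := fun X : Fin γ → sumRankBall (0 : MatTuple F m η ℓ) r => (fun t => (X t).1) ∈ E))
  rw [Nat.card_fun, Nat.card_fin] at this
  exact_mod_cast this

omit [Field F] [Finite F] in
theorem natCard_matTuple : Nat.card (MatTuple F m η ℓ) = Nat.card F ^ (m * (η * ℓ)) := by
  have h : Nat.card (Matrix (Fin m) (Fin η) F) = Nat.card F ^ (η * m) := by
    rw [pow_mul]
    exact (Nat.card_fun (α := Fin m) (β := Fin η → F)).trans (by simp [Nat.card_fun])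
  rw [Nat.card_fun, h, Nat.card_fin, ← pow_mul]
  congr 1
  ring

end

/-! ### The tail bound and the choice of K -/

/-- The tail bound for `γ` random points of a fixed ball. -/
theorem iidBallProb_large_span_le {F : Type*} [Field F] [Fintype F] {m η ℓ γ d : ℕ} {ρ δ : ℝ}
    (hρ : 0 ≤ ρ) (hγ : 1 ≤ γ) (hd : 4 ≤ d * δ)
    (hp : ∀ α α' : F, α ≠ 0 → α' ≠ 0 → ∀ b : MatTuple F m η ℓ,
        (Nat.card {p : sumRankBall (0 : MatTuple F m η ℓ) (ρ * (η * ℓ)) ×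
            sumRankBall (0 : MatTuple F m η ℓ) (ρ * (η * ℓ)) //
            α • p.1.1 + α' • p.2.1 + b ∈ sumRankBall 0 (ρ * (η * ℓ))} : ℝ) ≤
          (Nat.card F : ℝ) ^ (-(δ * (m * (η * ℓ)))) *
            (Nat.card (sumRankBall (0 : MatTuple F m η ℓ) (ρ * (η * ℓ))) : ℝ) ^ 2) :
    iidBallProb (F := F) (m := m) (η := η) (ℓ := ℓ) (ρ * (η * ℓ)) γ
        {X | (Fintype.card F : ℝ) ^ (2 * d) * γ ≤
          (((Submodule.span F (Set.range X) : Set (MatTuple F m η ℓ)) ∩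
            sumRankBall 0 (ρ * (η * ℓ))).ncard : ℝ)} ≤
      (Fintype.card F : ℝ) ^ (γ * (d + 1) - 3 * (m * (η * ℓ)) : ℝ) := by
  have : Finite (MatTuple F m η ℓ) := finite_matTuple
  have hq : (2 : ℝ) ≤ Fintype.card F := by exact_mod_cast Fintype.one_lt_card
  have hq0 : (0 : ℝ) < Fintype.card F := by linarith
  have hr : 0 ≤ ρ * (η * ℓ) := by positivity
  rw [Nat.card_eq_fintype_card (α := F)] at hp
  have h := card_large_span_inter_le (by positivity) hp hγ d
  rw [iidBallProb_eq hr]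
  set B := sumRankBall (0 : MatTuple F m η ℓ) (ρ * (η * ℓ)) with hB
  have hBpos : (0 : ℝ) < (Nat.card B : ℝ) ^ γ := by
    have : Nonempty B := ⟨0, zero_mem_sumRankBall hr⟩
    have : 0 < Nat.card B := Nat.card_pos
    positivity
  rw [div_le_iff₀ hBpos]
  have e : {X : Fin γ → B // (fun t => (X t).1) ∈ {X : Fin γ → MatTuple F m η ℓ |
        (Fintype.card F : ℝ) ^ (2 * d) * γ ≤
          (((Submodule.span F (Set.range X) : Set (MatTuple F m η ℓ)) ∩ B).ncard : ℝ)}} ≃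
      {X : Fin γ → B // Fintype.card F ^ (2 * d) * γ ≤
        ((Submodule.span F (Set.range fun t => (X t).1) : Set (MatTuple F m η ℓ)) ∩ B).ncard} :=
    Equiv.subtypeEquivRight fun X => by
      rw [Set.mem_ofPred_eq]
      exact_mod_cast Iff.rfl
  rw [Nat.card_congr e]
  refine h.trans ?_
  rw [← mul_assoc]
  refine mul_le_mul_of_nonneg_right ?_ hBpos.le
  rw [natCard_matTuple, Nat.card_eq_fintype_card, ← Real.rpow_natCast, Nat.cast_pow,
    ← Real.rpow_natCast, ← Real.rpow_natCast, ← Real.rpow_mul hq0.le, ← Real.rpow_add hq0,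
    ← Real.rpow_add hq0]
  -- The exponent is γ(d + 1) + mn - dδmn, and dδ ≥ 4.
  refine Real.rpow_le_rpow_of_exponent_le (by linarith) ?_
  have h2 : (0 : ℝ) ≤ m * (η * ℓ) := by positivity
  have h3 := mul_le_mul_of_nonneg_right hd h2
  push_cast
  linarith

theorem lemma6 {F : Type*} [Field F] [Fintype F]
    (ρ : ℝ) (hρ0 : 0 < ρ) (hρ1 : ρ < 1) (β : ℝ) (hβ : 0 < β) :
    ∃ K : ℝ, 1 < K ∧
      ∀ m η ℓ γ n : ℕ → ℕ,
        (∀ k, n k = η k * ℓ k) →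
        Tendsto m atTop atTop →
        (∀ k, β * (m k : ℝ) ≤ (η k : ℝ)) →
        (∀ k, η k ≤ m k) →
        (∀ k, 1 ≤ ℓ k) →
        (∀ k, 1 ≤ γ k) →
        ((fun k => (γ k : ℝ)) =o[atTop] fun k => Real.sqrt ((m k : ℝ) * (n k : ℝ))) →
        ∃ e : ℕ → ℝ, Tendsto e atTop (𝓝 0) ∧
          ∀ k,
            iidBallProb (F := F) (m := m k) (η := η k) (ℓ := ℓ k) (ρ * (n k : ℝ)) (γ k)
                {X | K * (γ k : ℝ) ≤
                  (((Submodule.span F (Set.range X) : Set (MatTuple F (m k) (η k) (ℓ k))) ∩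
                    sumRankBall 0 (ρ * (n k : ℝ))).ncard : ℝ)}
              ≤ (Fintype.card F : ℝ) ^ (-(3 - e k) * ((m k : ℝ) * (n k : ℝ))) := by
  have hq : (2 : ℝ) ≤ Fintype.card F := by exact_mod_cast Fintype.one_lt_card
  obtain ⟨δ, hδ, m₀, hm₀, hpair⟩ := exists_card_pair_le F hρ0 hρ1 hβ
  set d := ⌈4 / δ⌉₊ with hd
  have hdδ : 4 ≤ d * δ := by
    rw [← div_le_iff₀ hδ]
    exact Nat.le_ceil _
  have hd0 : d ≠ 0 := by
    rintro h
    rw [h] at hdδ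
    norm_num at hdδ
  refine ⟨(Fintype.card F : ℝ) ^ (2 * d), one_lt_pow₀ (by linarith) (by omega), ?_⟩
  intro m η ℓ γ n hn hm hβη hηm hℓ hγ ho
  -- For m k < m₀ the value 3 makes the claim the trivial bound by 1; this does not affect the limit
  -- since m k → ∞.
  refine ⟨fun k => if m₀ ≤ m k then (d + 1) * (γ k / (m k * n k)) else 3, ?_, fun k => ?_⟩
  -- Since √(mn) ≤ mn once mn ≥ 1, γ = o(√(mn)) gives γ/(mn) → 0.
  · have h1 : Tendsto (fun k => (γ k : ℝ) / (m k * n k)) atTop (𝓝 0) := by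
      refine squeeze_zero (fun k => by positivity) (fun k => ?_) ho.tendsto_div_nhds_zero
      rcases Nat.eq_zero_or_pos (m k * n k) with h0 | h0
      · have h0' : (m k : ℝ) * n k = 0 := by exact_mod_cast h0
        simp [h0']
      · have h1 : (1 : ℝ) ≤ m k * n k := by exact_mod_cast h0
        have h2 : Real.sqrt (m k * n k) ≤ m k * n k := by
          rw [Real.sqrt_le_left (by linarith)]
          nlinarith
        exact div_le_div_of_nonneg_left (by positivity) (Real.sqrt_pos.2 (by linarith)) h2
    have h2 := h1.const_mul ((d : ℝ) + 1)
    rw [mul_zero] at h2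
    refine h2.congr' ?_
    filter_upwards [hm.eventually_ge_atTop m₀] with k hk
    rw [if_pos hk]
  · have hnk : (n k : ℝ) = η k * ℓ k := by rw [hn k]; push_cast; rfl
    have hr : 0 ≤ ρ * (n k : ℝ) := by positivity
    dsimp only
    split_ifs with hk
    · have hmpos : (0 : ℝ) < m k := by exact_mod_cast (by omega : 0 < m k)
      have hηpos : (0 : ℝ) < η k := lt_of_lt_of_le (by positivity) (hβη k)
      have hℓpos : (0 : ℝ) < ℓ k := by exact_mod_cast hℓ k
      rw [hnk]
      refine (iidBallProb_large_span_le hρ0.le (hγ k) hdδ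
        (hpair (m k) (η k) (ℓ k) hk (hβη k) (hηm k) (hℓ k))).trans (le_of_eq ?_)
      congr 1
      field_simp
      ring
    · rw [sub_self, neg_zero, zero_mul, Real.rpow_zero]
      exact iidBallProb_le_one hr _ _
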